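/- All graphs are finite, simple and undirected. For $n\ge 1$, $P_n$ denotes the chordless path on $n$ vertices; writing that $abcd$ is an induced $P_4$ of a graph $G$ means that $a,b,c,d$ are distinct vertices whose induced subgraph has exactly the edges $ab,bc,cd$; its end-edges are $ab$ and $cd$. A graph $G$ is *distance-hereditary* if it contains none of the following as an induced subgraph: the gem ($P_4$ plus a vertex adjacent to all four of its vertices), the house (the complement of $P_5$), the domino (the cycle $C_6$ plus a chord joining two vertices at distance $3$), and the cycles $C_n$, $n\ge 5$. An *orientation* of $G$ replaces each edge $xy$ by exactly one of the arcs $x\to y$, $y\to x$. A graph $G$ is a *generalized opposition graph* if it has an orientation in which every induced $P_4$ $abcd$ has its end-edges in opposition, that is, either $a\to b$ and $d\to c$, or $b\to a$ and $c\to d$. It is an *opposition graph* if it has such an orientation that is in addition acyclic (has no directed cycle). The graph $\mathscr{O}(G)$ has as vertices all ordered pairs $(x,y)$ such that $\{x,y\}$ is an end-edge of an induced $P_4$ of $G$; two vertices $(x,y)$ and $(u,v)$ are adjacent if $(x,y)=(v,u)$, or $xyuv$ or $uvxy$ is an induced $P_4$ of $G$. Define the following graphs. - $\mathsf{T}_k$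 ($k\ge 1$): the path $p_0p_1\dots p_{2k+3}$ together with two further vertices $a,b$ of degree one, $a$ adjacent to $p_2$ and $b$ adjacent to $p_{2k+1}$. - $\mathsf{A}$: a cycle $C_4$ with a pendant vertex attached to each of two adjacent vertices of the cycle (two different pendant vertices). - $\mathsf{G_1}$: vertices $0,\dots,8$ and edges $01,12,23,34,45,26,36,67,78$ (a triangle $\{2,3,6\}$ with a path of two further vertices attached to each of its vertices). - $\mathsf{G_2}$: vertices $0,\dots,8$ and edges $01,12,23,34,45,26,36,27,37,78$. **Theorem.** For a distance-hereditary graph $G$, the following statements are equivalent: 1. $G$ is an opposition graph; 2. $G$ is a generalized opposition graph; 3. $\mathscr{O}(G)$ is bipartite; 4. $G$ contains none of $\mathsf{T}_k$ ($k\ge 1$), $\mathsf{A}$, $\mathsf{G_1}$, $\mathsf{G_2}$ as an induced subgraph. -/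

import Mathlib

namespace OppositionGraph

variable {V : Type*}

/-- `a b c d` is an induced (chordless) path on four vertices of `G`, with edges `ab`, `bc`, `cd`. -/
def IsInducedP4 (G : SimpleGraph V) (a b c d : V) : Prop :=
  (a ≠ c ∧ a ≠ d ∧ b ≠ d) ∧
  (G.Adj a b ∧ G.Adj b c ∧ G.Adj c d) ∧
  (¬ G.Adj a c ∧ ¬ G.Adj a d ∧ ¬ G.Adj b d)

/-- `D` is an orientation of `G`: each edge `xy` of `G` is replaced by exactly one of the
arcs `x → y`, `y → x` (here `D x y` means `x → y`), and `D` has no other arcs. -/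
def IsOrientation (G : SimpleGraph V) (D : V → V → Prop) : Prop :=
  (∀ x y, D x y → G.Adj x y) ∧ ∀ x y, G.Adj x y → Xor (D x y) (D y x)

/-- `D` has no directed cycle. -/
def IsAcyclicRel (D : V → V → Prop) : Prop :=
  ∀ x, ¬ Relation.TransGen D x x

/-- Every induced `P₄ abcd` of `G` has its end-edges `ab` and `cd` oriented in opposition by `D`:
either `a → b` and `d → c`, or `b → a` and `c → d`. -/
def OrientsInOpposition (G : SimpleGraph V) (D : V → V → Prop) : Prop :=
  ∀ a b c d, IsInducedP4 G a b c d → (D a b ∧ D d c) ∨ (D b a ∧ D c d)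

/-- Opposition graphs. -/
def IsOppositionGraph (G : SimpleGraph V) : Prop :=
  ∃ D : V → V → Prop, IsOrientation G D ∧ IsAcyclicRel D ∧ OrientsInOpposition G D

/-- Generalized opposition graphs: acyclicity of the orientation is not required. -/
def IsGeneralizedOppositionGraph (G : SimpleGraph V) : Prop :=
  ∃ D : V → V → Prop, IsOrientation G D ∧ OrientsInOpposition G D

/-- `{x, y}` is an end-edge of an induced `P₄` of `G`. -/
def IsEndEdge (G : SimpleGraph V) (x y : V) : Prop :=
  ∃ u v, IsInducedP4 G x y u v ∨ IsInducedP4 G y x u v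

theorem IsInducedP4.reverse {G : SimpleGraph V} {a b c d : V} (h : IsInducedP4 G a b c d) :
    IsInducedP4 G d c b a := by
  obtain ⟨⟨h1, h2, h3⟩, ⟨h4, h5, h6⟩, h7, h8, h9⟩ := h
  exact ⟨⟨h3.symm, h2.symm, h1.symm⟩, ⟨h6.symm, h5.symm, h4.symm⟩,
    fun h => h9 h.symm, fun h => h8 h.symm, fun h => h7 h.symm⟩

/-- The auxiliary graph `𝒪(G)`: its vertices are the ordered pairs `(x, y)` such that `{x, y}` is an
end-edge of an induced `P₄` of `G`; two vertices `(x, y)` and `(u, v)` are adjacent if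
`(x, y) = (v, u)`, or `xyuv` or `uvxy` is an induced `P₄` of `G`. -/
def auxGraph (G : SimpleGraph V) : SimpleGraph {p : V × V // IsEndEdge G p.1 p.2} where
  Adj p q :=
    (p.1.1 = q.1.2 ∧ p.1.2 = q.1.1) ∨
    IsInducedP4 G p.1.1 p.1.2 q.1.1 q.1.2 ∨ IsInducedP4 G q.1.1 q.1.2 p.1.1 p.1.2
  symm := ⟨by
    rintro p q (⟨h1, h2⟩ | h | h)
    · exact Or.inl ⟨h2.symm, h1.symm⟩
    · exact Or.inr (Or.inr h)
    · exact Or.inr (Or.inl h)⟩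
  loopless := ⟨by
    rintro ⟨⟨x, y⟩, u, v, hp⟩ (⟨h1, -⟩ | h | h)
    · change x = y at h1
      subst h1
      rcases hp with hp | hp <;> exact G.irrefl hp.2.1.1
    · exact h.1.1 rfl
    · exact h.1.1 rfl⟩

/-- The gem: the path `0 1 2 3` together with a vertex `4` adjacent to all its vertices. -/
def gem : SimpleGraph (Fin 5) :=
  SimpleGraph.fromEdgeSet {s(0, 1), s(1, 2), s(2, 3), s(4, 0), s(4, 1), s(4, 2), s(4, 3)}

/-- The house: the complement of the path on five vertices. -/
def house : SimpleGraph (Fin 5) := (SimpleGraph.pathGraph 5)ᶜ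

/-- The domino: the cycle `0 1 2 3 4 5` together with the chord `{0, 3}`. -/
def domino : SimpleGraph (Fin 6) :=
  SimpleGraph.fromEdgeSet {s(0, 1), s(1, 2), s(2, 3), s(3, 4), s(4, 5), s(5, 0), s(0, 3)}

/-- Distance-hereditary graphs: no induced gem, house, domino or hole (cycle of length at least
five). -/
def IsDistanceHereditary (G : SimpleGraph V) : Prop :=
  ¬ gem.IsIndContained G ∧ ¬ house.IsIndContained G ∧ ¬ domino.IsIndContained G ∧
    ∀ n, 5 ≤ n → ¬ (SimpleGraph.cycleGraph n).IsIndContained G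

/-- The tree `T_k` (`k ≥ 1`): the path `0, 1, …, 2k + 3`, a pendant vertex `2k + 4` attached to the
path vertex `2` and a pendant vertex `2k + 5` attached to the path vertex `2k + 1`. -/
def graphT (k : ℕ) : SimpleGraph (Fin (2 * k + 6)) :=
  SimpleGraph.fromRel fun i j =>
    (i.val + 1 = j.val ∧ j.val ≤ 2 * k + 3) ∨
    (i.val = 2 ∧ j.val = 2 * k + 4) ∨
    (i.val = 2 * k + 1 ∧ j.val = 2 * k + 5)

/-- The graph `A`: the cycle `1 4 5 2` of length four, with pendant vertices `0` at `1` and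
`3` at `2`. -/
def graphA : SimpleGraph (Fin 6) :=
  SimpleGraph.fromEdgeSet {s(0, 1), s(1, 2), s(2, 3), s(1, 4), s(4, 5), s(5, 2)}

/-- The graph `G₁`: the triangle `2 3 6`, with a path of two further vertices attached to each
of its vertices. -/
def graphG1 : SimpleGraph (Fin 9) :=
  SimpleGraph.fromEdgeSet {s(0, 1), s(1, 2), s(2, 3), s(3, 4), s(4, 5),
    s(2, 6), s(6, 7), s(7, 8), s(3, 6)}

/-- The graph `G₂`: the path `0 1 2 3 4 5`, two nonadjacent vertices `6` and `7`, both adjacent to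
`2` and `3`, and a pendant vertex `8` at `7`. -/
def graphG2 : SimpleGraph (Fin 9) :=
  SimpleGraph.fromEdgeSet {s(0, 1), s(1, 2), s(2, 3), s(3, 4), s(4, 5),
    s(6, 2), s(2, 7), s(7, 8), s(6, 3), s(3, 7)}

end OppositionGraph

/-!
The implication that needs work is from the excluded subgraphs to an acyclic orientation. An acyclic
orientation in opposition comes from an *opposition ranking*: a function on the vertices along which
both end-edges of every induced `P₄` ascend, or both descend, towards the middle. Such a ranking is
built by induction on the number of vertices.

*Reduction to chordal graphs.* An induced `P₄` with two vertices in a module lies inside the module,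
so rankings of a module and of the graph with the module contracted combine lexicographically
(`HasOppositionRanking.of_module`). Components of a disconnected graph are modules, and in the
absence of the house, the domino and `A`, every `C₄` lies across a nontrivial module
(`exists_module_of_square`). What remains are connected chordal graphs without gems.

*Layerings.* In such a graph consider the distance `l` from a root. The parents of a vertex form a
clique and adjacent vertices of one level have the same parents (`IsLayering`), so the levels along
an induced `P₄` follow one of five patterns (`IsLayering.levelPattern`). Ranking by the level folded
onto `0, 1, 2, 1, 0, 1, 2, 1, …`, as one would do in a tree, satisfies all patterns but two kinds:
the `vee`, which is violated if its bottom has the wrong parity, and the patterns with a horizontal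
end-edge, which are settled by ordering each level by the number of children having children, and
then by the degree inside the level. `IsGoodLayering` lists what has to be excluded for this to
work.

*The root.* If some vertex is the centre of a spider with legs of lengths `2, 2, 1`, take such a
centre with the most vertices at distance at most two. A `vee` at the wrong parity is the bottom of
a second spider at odd distance and gives a `T_k`; the other violations give `G₁` or `G₂`
(`IsObstructionFree.isGoodLayering_of_spider`). The maximality deals with the feet of the spider
that are adjacent to the first vertex of the path to the violation. If there is no spider, take an
end of a longest shortest path and shift the folding by one; the violations near the root are
excluded by looking at them from the other end of that path
(`IsObstructionFree.isGoodLayering_of_not_spider`).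

For the converse, an orientation in opposition propagates along induced `P₄`s, and in each of `T_k`,
`A`, `G₁`, `G₂` it returns to an edge with the wrong direction.
-/

open OppositionGraph

/-! ### Embeddings of small graphs -/

theorem isIndContained_of_injective {V W : Type*} {H : SimpleGraph W} {G : SimpleGraph V}
    (φ : W → V) (hφ : Function.Injective φ) (h : ∀ i j, G.Adj (φ i) (φ j) ↔ H.Adj i j) :
    H.IsIndContained G :=
  ⟨⟨⟨φ, hφ⟩, fun {i j} => h i j⟩⟩

/-- If no two vertices of `H` have the same neighbours, then a map that preserves and reflects
adjacency is automatically injective. -/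
theorem isIndContained_of_rows {V W : Type*} {H : SimpleGraph W} {G : SimpleGraph V}
    (φ : W → V) (hr : ∀ i j, (∀ k, H.Adj i k ↔ H.Adj j k) → i = j)
    (h : ∀ i j, G.Adj (φ i) (φ j) ↔ H.Adj i j) : H.IsIndContained G :=
  isIndContained_of_injective φ
    (fun i j hij => hr i j fun k => by rw [← h, ← h, hij]) h

theorem graphG1_isIndContained {V : Type*} {G : SimpleGraph V} (v0 v1 v2 v3 v4 v5 v6 v7 v8 : V)
    (h01 : G.Adj v0 v1) (h02 : ¬ G.Adj v0 v2) (h03 : ¬ G.Adj v0 v3) (h04 : ¬ G.Adj v0 v4)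
    (h05 : ¬ G.Adj v0 v5) (h06 : ¬ G.Adj v0 v6) (h07 : ¬ G.Adj v0 v7) (h08 : ¬ G.Adj v0 v8)
    (h12 : G.Adj v1 v2) (h13 : ¬ G.Adj v1 v3) (h14 : ¬ G.Adj v1 v4) (h15 : ¬ G.Adj v1 v5)
    (h16 : ¬ G.Adj v1 v6) (h17 : ¬ G.Adj v1 v7) (h18 : ¬ G.Adj v1 v8)
    (h23 : G.Adj v2 v3) (h24 : ¬ G.Adj v2 v4) (h25 : ¬ G.Adj v2 v5) (h26 : G.Adj v2 v6)
    (h27 : ¬ G.Adj v2 v7) (h28 : ¬ G.Adj v2 v8)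
    (h34 : G.Adj v3 v4) (h35 : ¬ G.Adj v3 v5) (h36 : G.Adj v3 v6) (h37 : ¬ G.Adj v3 v7)
    (h38 : ¬ G.Adj v3 v8)
    (h45 : G.Adj v4 v5) (h46 : ¬ G.Adj v4 v6) (h47 : ¬ G.Adj v4 v7) (h48 : ¬ G.Adj v4 v8)
    (h56 : ¬ G.Adj v5 v6) (h57 : ¬ G.Adj v5 v7) (h58 : ¬ G.Adj v5 v8)
    (h67 : G.Adj v6 v7) (h68 : ¬ G.Adj v6 v8) (h78 : G.Adj v7 v8) :
    graphG1.IsIndContained G := by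
  refine isIndContained_of_rows ![v0, v1, v2, v3, v4, v5, v6, v7, v8] ?_ ?_
  · simp only [graphG1, SimpleGraph.fromEdgeSet_adj]
    decide
  · simp only [Fin.forall_fin_succ, graphG1, SimpleGraph.fromEdgeSet_adj]
    simp [*, G.adj_comm, Fin.ext_iff]

theorem graphG2_isIndContained {V : Type*} {G : SimpleGraph V} (v0 v1 v2 v3 v4 v5 v6 v7 v8 : V)
    (h01 : G.Adj v0 v1) (h02 : ¬ G.Adj v0 v2) (h03 : ¬ G.Adj v0 v3) (h04 : ¬ G.Adj v0 v4)
    (h05 : ¬ G.Adj v0 v5) (h06 : ¬ G.Adj v0 v6) (h07 : ¬ G.Adj v0 v7) (h08 : ¬ G.Adj v0 v8)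
    (h12 : G.Adj v1 v2) (h13 : ¬ G.Adj v1 v3) (h14 : ¬ G.Adj v1 v4) (h15 : ¬ G.Adj v1 v5)
    (h16 : ¬ G.Adj v1 v6) (h17 : ¬ G.Adj v1 v7) (h18 : ¬ G.Adj v1 v8)
    (h23 : G.Adj v2 v3) (h24 : ¬ G.Adj v2 v4) (h25 : ¬ G.Adj v2 v5) (h26 : G.Adj v2 v6)
    (h27 : G.Adj v2 v7) (h28 : ¬ G.Adj v2 v8)
    (h34 : G.Adj v3 v4) (h35 : ¬ G.Adj v3 v5) (h36 : G.Adj v3 v6) (h37 : G.Adj v3 v7)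
    (h38 : ¬ G.Adj v3 v8)
    (h45 : G.Adj v4 v5) (h46 : ¬ G.Adj v4 v6) (h47 : ¬ G.Adj v4 v7) (h48 : ¬ G.Adj v4 v8)
    (h56 : ¬ G.Adj v5 v6) (h57 : ¬ G.Adj v5 v7) (h58 : ¬ G.Adj v5 v8)
    (h67 : ¬ G.Adj v6 v7) (h68 : ¬ G.Adj v6 v8) (h78 : G.Adj v7 v8) :
    graphG2.IsIndContained G := by
  refine isIndContained_of_rows ![v0, v1, v2, v3, v4, v5, v6, v7, v8] ?_ ?_
  · simp only [graphG2, SimpleGraph.fromEdgeSet_adj]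
    decide
  · simp only [Fin.forall_fin_succ, graphG2, SimpleGraph.fromEdgeSet_adj]
    simp [*, G.adj_comm, Fin.ext_iff]

theorem graphA_isIndContained {V : Type*} {G : SimpleGraph V} (v0 v1 v2 v3 v4 v5 : V)
    (h01 : G.Adj v0 v1) (h02 : ¬ G.Adj v0 v2) (h03 : ¬ G.Adj v0 v3) (h04 : ¬ G.Adj v0 v4)
    (h05 : ¬ G.Adj v0 v5)
    (h12 : G.Adj v1 v2) (h13 : ¬ G.Adj v1 v3) (h14 : G.Adj v1 v4) (h15 : ¬ G.Adj v1 v5)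
    (h23 : G.Adj v2 v3) (h24 : ¬ G.Adj v2 v4) (h25 : G.Adj v2 v5)
    (h34 : ¬ G.Adj v3 v4) (h35 : ¬ G.Adj v3 v5) (h45 : G.Adj v4 v5) :
    graphA.IsIndContained G := by
  refine isIndContained_of_rows ![v0, v1, v2, v3, v4, v5] ?_ ?_
  · simp only [graphA, SimpleGraph.fromEdgeSet_adj]
    decide
  · simp only [Fin.forall_fin_succ, graphA, SimpleGraph.fromEdgeSet_adj]
    simp [*, G.adj_comm, Fin.ext_iff]

theorem domino_isIndContained {V : Type*} {G : SimpleGraph V} (v0 v1 v2 v3 v4 v5 : V)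
    (h01 : G.Adj v0 v1) (h02 : ¬ G.Adj v0 v2) (h03 : G.Adj v0 v3) (h04 : ¬ G.Adj v0 v4)
    (h05 : G.Adj v0 v5)
    (h12 : G.Adj v1 v2) (h13 : ¬ G.Adj v1 v3) (h14 : ¬ G.Adj v1 v4) (h15 : ¬ G.Adj v1 v5)
    (h23 : G.Adj v2 v3) (h24 : ¬ G.Adj v2 v4) (h25 : ¬ G.Adj v2 v5)
    (h34 : G.Adj v3 v4) (h35 : ¬ G.Adj v3 v5) (h45 : G.Adj v4 v5) :
    domino.IsIndContained G := by
  refine isIndContained_of_rows ![v0, v1, v2, v3, v4, v5] ?_ ?_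
  · simp only [domino, SimpleGraph.fromEdgeSet_adj]
    decide
  · simp only [Fin.forall_fin_succ, domino, SimpleGraph.fromEdgeSet_adj]
    simp [*, G.adj_comm, Fin.ext_iff]

/-- The vertex `u` is the roof of the house over the square `x x' y' y`. -/
theorem house_isIndContained {V : Type*} {G : SimpleGraph V} (u x y x' y' : V)
    (hxy : G.Adj x y) (hxy' : G.Adj x y') (hx'y : G.Adj x' y) (hx'y' : G.Adj x' y')
    (hxx' : ¬ G.Adj x x') (hyy' : ¬ G.Adj y y')
    (hux : G.Adj u x) (huy : G.Adj u y) (hux' : ¬ G.Adj u x') (huy' : ¬ G.Adj u y') :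
    house.IsIndContained G := by
  have hyx' := hx'y.symm
  refine isIndContained_of_rows ![x, x', u, y', y] ?_ ?_
  · simp only [house, SimpleGraph.compl_adj, SimpleGraph.pathGraph_adj]
    decide
  · simp only [Fin.forall_fin_succ, house, SimpleGraph.compl_adj, SimpleGraph.pathGraph_adj]
    simp [*, G.adj_comm, Fin.ext_iff]

theorem gem_isIndContained {V : Type*} {G : SimpleGraph V} {a b c d v : V}
    (h : IsInducedP4 G a b c d) (ha : G.Adj v a) (hb : G.Adj v b) (hc : G.Adj v c)
    (hd : G.Adj v d) : gem.IsIndContained G := by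
  obtain ⟨-, ⟨h1, h2, h3⟩, h4, h5, h6⟩ := h
  have ha' := ha.symm
  have hb' := hb.symm
  have hc' := hc.symm
  have hd' := hd.symm
  refine isIndContained_of_rows ![a, b, c, d, v] ?_ ?_
  · simp only [gem, SimpleGraph.fromEdgeSet_adj]
    decide
  · simp only [Fin.forall_fin_succ, gem, SimpleGraph.fromEdgeSet_adj]
    simp [*, G.adj_comm, Fin.ext_iff]

/-! ### Gem-free chordal graphs -/

/-- Gem-free chordal graphs, given by forbidden induced subgraphs. -/
structure IsPtolemaic {V : Type*} (G : SimpleGraph V) : Prop where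
  not_gem : ¬ gem.IsIndContained G
  not_hole : ∀ n, 4 ≤ n → ¬ (SimpleGraph.cycleGraph n).IsIndContained G

theorem cycleGraph_adj_iff_of_lt {n : ℕ} {i j : Fin n} (hij : i < j) :
    (SimpleGraph.cycleGraph n).Adj i j ↔ (i : ℕ) + 1 = j ∨ ((i : ℕ) = 0 ∧ (j : ℕ) + 1 = n) := by
  have hi := i.2
  have hj := j.2
  have hij' : (i : ℕ) < j := hij
  rw [SimpleGraph.cycleGraph_adj', Fin.sub_val_of_le hij.le, Fin.coe_sub_iff_lt.2 hij]
  omega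

/-- The restriction of a graph to the edges inside a set of vertices, on the same vertex type. -/
def restrict {V : Type*} (G : SimpleGraph V) (S : V → Prop) : SimpleGraph V where
  Adj u v := G.Adj u v ∧ S u ∧ S v
  symm := ⟨fun _ _ h => ⟨h.1.symm, h.2.2, h.2.1⟩⟩
  loopless := ⟨fun _ h => G.irrefl h.1⟩

namespace IsPtolemaic

variable {V : Type*} {G : SimpleGraph V}

/-- Two nonadjacent neighbours of `x` lie in different components of what is left of `G` when the
other vertices of the closed neighbourhood of `x` are removed: a shortest connecting path would
close up to a hole through `x`. -/
theorem not_reachable (hG : IsPtolemaic G) {x p q : V} (hp : G.Adj x p) (hq : G.Adj x q)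
    (hpq : p ≠ q) (hnpq : ¬ G.Adj p q) (S : V → Prop)
    (hS : ∀ v, S v → v ≠ p → v ≠ q → v ≠ x ∧ ¬ G.Adj x v) (hx : ¬ S x) :
    ¬ (restrict G S).Reachable p q := by
  set H := restrict G S with hH
  intro hr
  obtain ⟨w, hw⟩ := hr.exists_walk_length_eq_dist
  set m := w.length with hm
  set f := w.getVert with hf
  have hadj : ∀ j < m, H.Adj (f j) (f (j + 1)) := fun j hj => w.adj_getVert_succ hj
  have h0 : f 0 = p := w.getVert_zero
  have hmq : f m = q := w.getVert_length
  have hdist : ∀ j ≤ m, H.dist p (f j) = j ∧ H.Reachable p (f j) := by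
    intro j hj
    have h1 : H.dist p (f j) ≤ j := by
      have := SimpleGraph.dist_le (w.take j)
      rw [SimpleGraph.Walk.take_length] at this
      exact this.trans (min_le_left _ _)
    have h2 : H.dist (f j) q ≤ m - j := by
      have := SimpleGraph.dist_le (w.drop j)
      rwa [SimpleGraph.Walk.drop_length] at this
    have hrj : H.Reachable p (f j) := (w.take j).reachable
    have h3 := hrj.dist_triangle_left q
    have hw' : H.dist p q = m := hw.symm
    exact ⟨by omega, hrj⟩
  have hm0 : m ≠ 0 := by
    intro h; rw [h, h0] at hmq; exact hpq hmq
  have hm1 : m ≠ 1 := by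
    intro h
    have := hadj 0 (by omega)
    rw [h] at hmq
    simp only [zero_add, h0, hmq] at this
    exact hnpq this.1
  have hSf : ∀ j ≤ m, S (f j) := by
    intro j hj
    rcases Nat.lt_or_ge j m with h | h
    · exact (hadj j h).2.1
    · have := (hadj (j - 1) (by omega)).2.2
      rwa [show j - 1 + 1 = j by omega] at this
  have hinj : ∀ i j, i ≤ m → j ≤ m → f i = f j → i = j := by
    intro i j hi hj hij
    rw [← (hdist i hi).1, ← (hdist j hj).1, hij]
  have hfadj : ∀ i j, i < j → j ≤ m → (G.Adj (f i) (f j) ↔ i + 1 = j) := by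
    intro i j hij hj
    constructor
    · intro h
      have hH' : H.Adj (f i) (f j) := ⟨h, hSf i (by omega), hSf j hj⟩
      have h1 := (hdist i (by omega)).2.dist_triangle_left (f j)
      have h2 := SimpleGraph.dist_eq_one_iff_adj.2 hH'
      have h3 := (hdist i (by omega)).1
      have h4 := (hdist j (by omega)).1
      omega
    · rintro rfl
      exact (hadj i (by omega)).1
  have hfx : ∀ i ≤ m, f i ≠ x := fun i hi h => hx (h ▸ hSf i hi)
  have hfxadj : ∀ i ≤ m, (G.Adj (f i) x ↔ i = 0 ∨ i = m) := by
    intro i hi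
    constructor
    · intro h
      by_contra hne
      push Not at hne
      exact (hS (f i) (hSf i hi) (fun h' => hne.1 (hinj i 0 hi (by omega) (h'.trans h0.symm)))
        (fun h' => hne.2 (hinj i m hi le_rfl (h'.trans hmq.symm)))).2 h.symm
    · rintro (rfl | rfl)
      · rw [h0]; exact hp.symm
      · rw [hmq]; exact hq.symm
  set φ : Fin (m + 2) → V := fun i => if (i : ℕ) ≤ m then f i else x with hφ
  have hlt : ∀ i j : Fin (m + 2), i < j →
      φ i ≠ φ j ∧ (G.Adj (φ i) (φ j) ↔ (SimpleGraph.cycleGraph (m + 2)).Adj i j) := by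
    intro i j hij
    have hij' : (i : ℕ) < j := hij
    have hj2 := j.2
    rw [cycleGraph_adj_iff_of_lt hij]
    have hi : (i : ℕ) ≤ m := by omega
    simp only [hφ, if_pos hi]
    by_cases hj : (j : ℕ) ≤ m
    · rw [if_pos hj, hfadj _ _ hij' hj]
      refine ⟨fun h => hij'.ne (hinj _ _ hi hj h), by omega⟩
    · rw [if_neg hj, hfxadj _ hi]
      exact ⟨hfx _ hi, by omega⟩
  refine hG.not_hole (m + 2) (by omega) (isIndContained_of_injective φ ?_ ?_)
  · intro i j hij
    rcases lt_trichotomy i j with h | h | h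
    · exact absurd hij (hlt i j h).1
    · exact h
    · exact absurd hij.symm (hlt j i h).1
  · intro i j
    rcases lt_trichotomy i j with h | h | h
    · exact (hlt i j h).2
    · subst h; simp
    · rw [G.adj_comm, (hlt j i h).2, SimpleGraph.adj_comm]

theorem gem_free (hG : IsPtolemaic G) {a b c d v : V} (h : IsInducedP4 G a b c d)
    (ha : G.Adj v a) (hb : G.Adj v b) (hc : G.Adj v c) (hd : G.Adj v d) : False :=
  hG.not_gem (gem_isIndContained h ha hb hc hd)

/-- Chordality for closed walks of length four. -/
theorem chord_four (hG : IsPtolemaic G) {x p d q : V} (hp : G.Adj x p) (hq : G.Adj x q)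
    (hpd : G.Adj p d) (hdq : G.Adj d q) (hpq : p ≠ q) (hnpq : ¬ G.Adj p q) :
    d = x ∨ G.Adj x d := by
  by_contra h
  push Not at h
  refine hG.not_reachable hp hq hpq hnpq (fun v => v = p ∨ v = q ∨ v = d) ?_ ?_ ?_
  · rintro v (rfl | rfl | rfl) h1 h2
    exacts [absurd rfl h1, absurd rfl h2, h]
  · rintro (rfl | rfl | rfl)
    exacts [G.irrefl hp, G.irrefl hq, h.1 rfl]
  · have h1 : (restrict G (fun v => v = p ∨ v = q ∨ v = d)).Adj p d := ⟨hpd, by simp, by simp⟩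
    have h2 : (restrict G (fun v => v = p ∨ v = q ∨ v = d)).Adj d q := ⟨hdq, by simp, by simp⟩
    exact h1.reachable.trans h2.reachable

/-- Chordality for closed walks of length five. -/
theorem chord_five (hG : IsPtolemaic G) {x p d e q : V} (hp : G.Adj x p) (hq : G.Adj x q)
    (hpd : G.Adj p d) (hde : G.Adj d e) (heq : G.Adj e q) (hpq : p ≠ q) (hnpq : ¬ G.Adj p q) :
    d = x ∨ G.Adj x d ∨ e = x ∨ G.Adj x e := by
  by_contra h
  push Not at h
  refine hG.not_reachable hp hq hpq hnpq (fun v => v = p ∨ v = q ∨ v = d ∨ v = e) ?_ ?_ ?_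
  · rintro v (rfl | rfl | rfl | rfl) h1 h2
    exacts [absurd rfl h1, absurd rfl h2, ⟨h.1, h.2.1⟩, h.2.2]
  · rintro (rfl | rfl | rfl | rfl)
    exacts [G.irrefl hp, G.irrefl hq, h.1 rfl, h.2.2.1 rfl]
  · set S : V → Prop := fun v => v = p ∨ v = q ∨ v = d ∨ v = e
    have h1 : (restrict G S).Adj p d := ⟨hpd, by simp [S], by simp [S]⟩
    have h2 : (restrict G S).Adj d e := ⟨hde, by simp [S], by simp [S]⟩
    have h3 : (restrict G S).Adj e q := ⟨heq, by simp [S], by simp [S]⟩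
    exact h1.reachable.trans (h2.reachable.trans h3.reachable)

/-- Chordality for closed walks of length six. -/
theorem chord_six (hG : IsPtolemaic G) {x p d e f q : V} (hp : G.Adj x p) (hq : G.Adj x q)
    (hpd : G.Adj p d) (hde : G.Adj d e) (hef : G.Adj e f) (hfq : G.Adj f q) (hpq : p ≠ q)
    (hnpq : ¬ G.Adj p q) :
    d = x ∨ G.Adj x d ∨ e = x ∨ G.Adj x e ∨ f = x ∨ G.Adj x f := by
  by_contra h
  push Not at h
  refine hG.not_reachable hp hq hpq hnpq
    (fun v => v = p ∨ v = q ∨ v = d ∨ v = e ∨ v = f) ?_ ?_ ?_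
  · rintro v (rfl | rfl | rfl | rfl | rfl) h1 h2
    exacts [absurd rfl h1, absurd rfl h2, ⟨h.1, h.2.1⟩, ⟨h.2.2.1, h.2.2.2.1⟩, h.2.2.2.2]
  · rintro (rfl | rfl | rfl | rfl | rfl)
    exacts [G.irrefl hp, G.irrefl hq, h.1 rfl, h.2.2.1 rfl, h.2.2.2.2.1 rfl]
  · set S : V → Prop := fun v => v = p ∨ v = q ∨ v = d ∨ v = e ∨ v = f
    have h1 : (restrict G S).Adj p d := ⟨hpd, by simp [S], by simp [S]⟩
    have h2 : (restrict G S).Adj d e := ⟨hde, by simp [S], by simp [S]⟩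
    have h3 : (restrict G S).Adj e f := ⟨hef, by simp [S], by simp [S]⟩
    have h4 : (restrict G S).Adj f q := ⟨hfq, by simp [S], by simp [S]⟩
    exact h1.reachable.trans (h2.reachable.trans (h3.reachable.trans h4.reachable))

/-- The ends of an induced `P₄` are nonadjacent as soon as the other two pairs are. -/
theorem not_adj_ends (hG : IsPtolemaic G) {a b c d : V} (hab : G.Adj a b) (hbc : G.Adj b c)
    (hcd : G.Adj c d) (hac : ¬ G.Adj a c) (hbd : ¬ G.Adj b d) (nac : a ≠ c) (nbd : b ≠ d) :
    ¬ G.Adj a d := by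
  intro had
  rcases hG.chord_four hab had hbc hcd nbd hbd with h | h
  exacts [nac h.symm, hac h]

/-- The ends of an induced `P₅` are nonadjacent as soon as its three inner nonadjacencies hold. -/
theorem not_adj_ends_five (hG : IsPtolemaic G) {a b c d e : V} (hab : G.Adj a b)
    (hbc : G.Adj b c) (hcd : G.Adj c d) (hde : G.Adj d e) (hac : ¬ G.Adj a c) (hbd : ¬ G.Adj b d)
    (hce : ¬ G.Adj c e) (nac : a ≠ c) (nbd : b ≠ d) (nce : c ≠ e) : ¬ G.Adj a e := by
  intro hae
  have h1 := hG.not_adj_ends hab hbc hcd hac hbd nac nbd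
  have h2 := hG.not_adj_ends hbc hcd hde hbd hce nbd nce
  rcases hG.chord_five hab hae hbc hcd hde (by rintro rfl; exact hce hbc.symm) h2 with
    h | h | h | h
  exacts [nac h.symm, hac h, hac (h ▸ hcd.symm), h1 h]

/-- The ends of an induced `P₆` are nonadjacent as soon as its four inner nonadjacencies hold. -/
theorem not_adj_ends_six (hG : IsPtolemaic G) {a b c d e f : V} (hab : G.Adj a b)
    (hbc : G.Adj b c) (hcd : G.Adj c d) (hde : G.Adj d e) (hef : G.Adj e f) (hac : ¬ G.Adj a c)
    (hbd : ¬ G.Adj b d) (hce : ¬ G.Adj c e) (hdf : ¬ G.Adj d f) (nac : a ≠ c) (nbd : b ≠ d)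
    (nce : c ≠ e) (ndf : d ≠ f) : ¬ G.Adj a f := by
  intro haf
  have h1 := hG.not_adj_ends hab hbc hcd hac hbd nac nbd
  have h2 := hG.not_adj_ends_five hab hbc hcd hde hac hbd hce nac nbd nce
  have h3 := hG.not_adj_ends_five hbc hcd hde hef hbd hce hdf nbd nce ndf
  have h4 := hG.not_adj_ends hcd hde hef hce hdf nce ndf
  rcases hG.chord_six hab haf hbc hcd hde hef (by rintro rfl; exact h4 hbc.symm) h3 with
    h | h | h | h | h | h
  exacts [nac h.symm, hac h, hac (h ▸ hcd.symm), h1 h, h1 (h ▸ hde.symm), h2 h]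

/-- If the adjacent vertices `c` and `q` have two nonadjacent common neighbours, then these are
adjacent to no private neighbour of `q`. -/
theorem not_adj_of_diamond (hG : IsPtolemaic G) {c q u v z : V} (hcq : G.Adj c q)
    (hcu : G.Adj c u) (hqu : G.Adj q u) (hcv : G.Adj c v) (hqv : G.Adj q v) (nuv : u ≠ v)
    (huv : ¬ G.Adj u v) (hqz : G.Adj q z) (hcz : ¬ G.Adj c z) (nzc : z ≠ c) : ¬ G.Adj z u := by
  intro hzu
  have hzv : ¬ G.Adj z v := by
    intro hzv
    rcases hG.chord_four hzu hzv hcu.symm hcv nuv huv with h | h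
    exacts [nzc h.symm, hcz h.symm]
  refine hG.gem_free (a := z) (b := u) (c := c) (d := v) (v := q)
    ⟨⟨nzc, ?_, nuv⟩, ⟨hzu, hcu.symm, hcv⟩, fun h => hcz h.symm, hzv, huv⟩ hqz hqu hcq.symm hqv
  rintro rfl
  exact hcz hcv

/-- `G₁` from a triangle with a path of two vertices hanging off each of its vertices; chordality
supplies the remaining nonadjacencies. -/
theorem graphG1_of (hG : IsPtolemaic G) {a b c a' b' c' a'' b'' c'' : V}
    (hab : G.Adj a b) (hac : G.Adj a c) (hbc : G.Adj b c)
    (ha : G.Adj a a') (hba' : ¬ G.Adj b a') (hca' : ¬ G.Adj c a')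
    (hb : G.Adj b b') (hab' : ¬ G.Adj a b') (hcb' : ¬ G.Adj c b')
    (hc : G.Adj c c') (hac' : ¬ G.Adj a c') (hbc' : ¬ G.Adj b c')
    (ha' : G.Adj a' a'') (haa : ¬ G.Adj a a'') (na : a'' ≠ a)
    (hb' : G.Adj b' b'') (hbb : ¬ G.Adj b b'') (nb : b'' ≠ b)
    (hc' : G.Adj c' c'') (hcc : ¬ G.Adj c c'') (nc : c'' ≠ c) : graphG1.IsIndContained G := by
  -- facts about one edge `xy` of the triangle and the two paths hanging off its ends
  have key : ∀ x y z x' y' x'' y'' : V, G.Adj x y → G.Adj x z → G.Adj y z → G.Adj x x' →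
      G.Adj y y' → ¬ G.Adj y x' → ¬ G.Adj z x' → ¬ G.Adj x y' → ¬ G.Adj z y' → G.Adj x' x'' →
      ¬ G.Adj x x'' → x'' ≠ x → G.Adj y' y'' → ¬ G.Adj y y'' → y'' ≠ y →
      ¬ G.Adj x' y' ∧ ¬ G.Adj x'' y ∧ ¬ G.Adj x'' y' ∧ ¬ G.Adj x' y'' ∧
        ¬ G.Adj x'' y'' ∧ ¬ G.Adj x y'' := by
    intro x y z x' y' x'' y'' h1 h2 h3 h4 h5 h6 h7 h8 h9 h10 h11 h12 h13 h14 h15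
    have e1 : x' ≠ y := by rintro rfl; exact h7 h3.symm
    have e2 : y' ≠ x := by rintro rfl; exact h9 h2.symm
    have i6 : ¬ G.Adj x' y := fun h => h6 h.symm
    have i11 : ¬ G.Adj x'' x := fun h => h11 h.symm
    refine ⟨hG.not_adj_ends h4.symm h1 h5 i6 h8 e1 e2.symm,
      hG.not_adj_ends h10.symm h4.symm h1 i11 i6 h12 e1,
      hG.not_adj_ends_five h10.symm h4.symm h1 h5 i11 i6 h8 h12 e1 e2.symm,
      hG.not_adj_ends_five h4.symm h1 h5 h13 i6 h8 h14 e1 e2.symm h15.symm,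
      hG.not_adj_ends_six h10.symm h4.symm h1 h5 h13 i11 i6 h8 h14 h12 e1 e2.symm h15.symm,
      hG.not_adj_ends h1 h5 h13 h8 h14 e2.symm h15.symm⟩
  obtain ⟨k1, k2, k3, k4, k5, k6⟩ := key a b c a' b' a'' b'' hab hac hbc ha hb hba' hca' hab' hcb'
    ha' haa na hb' hbb nb
  obtain ⟨l1, l2, l3, l4, l5, l6⟩ := key a c b a' c' a'' c'' hac hab hbc.symm ha hc hca' hba' hac'
    hbc' ha' haa na hc' hcc nc
  obtain ⟨m1, m2, m3, m4, m5, m6⟩ := key b c a b' c' b'' c'' hbc hab.symm hac.symm hb hc hcb' hab'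
    hbc' hac' hb' hbb nb hc' hcc nc
  have n : ∀ {x y : V}, ¬ G.Adj x y → ¬ G.Adj y x := fun h h' => h h'.symm
  exact graphG1_isIndContained a'' a' a b b' b'' c c' c'' ha'.symm (n haa) k2 k3 k5 l2 l3 l5
    ha.symm (n hba') k1 k4 (n hca') l1 l4 hab hab' k6 hac hac' l6 hb hbb hbc hbc' m6 hb'
    (n hcb') m1 m4 m2 m3 m5 hc hcc hc'

/-- `G₂` from two adjacent vertices `p`, `b` with nonadjacent common neighbours `a`, `c`; chordality
and the absence of gems supply the remaining nonadjacencies. -/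
theorem graphG2_of (hG : IsPtolemaic G) {p b a c d p' p'' e f : V}
    (hpb : G.Adj p b) (hpa : G.Adj p a) (hpc : G.Adj p c) (hba : G.Adj b a) (hbc : G.Adj b c)
    (hac : ¬ G.Adj a c) (nac : a ≠ c)
    (hcd : G.Adj c d) (hpd : ¬ G.Adj p d) (npd : p ≠ d) (hbd : ¬ G.Adj b d) (nbd : b ≠ d)
    (hpp' : G.Adj p p') (hbp' : ¬ G.Adj b p') (nbp' : b ≠ p')
    (hp' : G.Adj p' p'') (hpp'' : ¬ G.Adj p p'') (np : p ≠ p'')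
    (hbe : G.Adj b e) (hpe : ¬ G.Adj p e) (npe : p ≠ e)
    (hef : G.Adj e f) (hbf : ¬ G.Adj b f) (nbf : b ≠ f) : graphG2.IsIndContained G := by
  have n : ∀ {x y : V}, ¬ G.Adj x y → ¬ G.Adj y x := fun h h' => h h'.symm
  have hp'a := hG.not_adj_of_diamond hpb.symm hba hpa hbc hpc nac hac hpp' hbp' nbp'.symm
  have hp'c := hG.not_adj_of_diamond hpb.symm hbc hpc hba hpa nac.symm (n hac) hpp' hbp' nbp'.symm
  have hea := hG.not_adj_of_diamond hpb hpa hba hpc hbc nac hac hbe hpe npe.symm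
  have hec := hG.not_adj_of_diamond hpb hpc hbc hpa hba nac.symm (n hac) hbe hpe npe.symm
  have np'a : p' ≠ a := by rintro rfl; exact hbp' hba
  have np'c : p' ≠ c := by rintro rfl; exact hbp' hbc
  have nea : e ≠ a := by rintro rfl; exact hpe hpa
  have nec : e ≠ c := by rintro rfl; exact hpe hpc
  exact graphG2_isIndContained p'' p' p b e f a c d hp'.symm (n hpp'')
    (hG.not_adj_ends hp'.symm hpp'.symm hpb (n hpp'') (n hbp') np.symm nbp'.symm)
    (hG.not_adj_ends_five hp'.symm hpp'.symm hpb hbe (n hpp'') (n hbp') hpe np.symm nbp'.symm npe)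
    (hG.not_adj_ends_six hp'.symm hpp'.symm hpb hbe hef (n hpp'') (n hbp') hpe hbf np.symm
      nbp'.symm npe nbf)
    (hG.not_adj_ends hp'.symm hpp'.symm hpa (n hpp'') hp'a np.symm np'a)
    (hG.not_adj_ends hp'.symm hpp'.symm hpc (n hpp'') hp'c np.symm np'c)
    (hG.not_adj_ends_five hp'.symm hpp'.symm hpc hcd (n hpp'') hp'c hpd np.symm np'c npd)
    hpp'.symm (n hbp')
    (hG.not_adj_ends hpp'.symm hpb hbe (n hbp') hpe nbp'.symm npe)
    (hG.not_adj_ends_five hpp'.symm hpb hbe hef (n hbp') hpe hbf nbp'.symm npe nbf)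
    hp'a hp'c
    (hG.not_adj_ends hpp'.symm hpc hcd hp'c hpd np'c npd)
    hpb hpe (hG.not_adj_ends hpb hbe hef hpe hbf npe nbf) hpa hpc hpd
    hbe hbf hba hbc hbd hef hea hec
    (hG.not_adj_ends hbe.symm hbc hcd hec hbd nec nbd)
    (hG.not_adj_ends hef.symm hbe.symm hba (n hbf) hea nbf.symm nea)
    (hG.not_adj_ends hef.symm hbe.symm hbc (n hbf) hec nbf.symm nec)
    (hG.not_adj_ends_five hef.symm hbe.symm hbc hcd (n hbf) hec hbd nbf.symm nec nbd)
    hac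
    (hG.not_adj_ends hpa.symm hpc hcd hac hpd nac npd) hcd

end IsPtolemaic

/-! ### Distance layerings -/

/-- The properties of the distance from a root vertex that hold in connected gem-free chordal
graphs. A neighbour one level closer to the root is called a *parent*, and the fields `clique` and
`same` say that the parents of a vertex form a clique and that adjacent vertices of the same level
have the same parents. -/
structure IsLayering {V : Type*} (G : SimpleGraph V) (l : V → ℕ) : Prop where
  zero : ∀ {u v}, l u = 0 → l v = 0 → u = v
  le : ∀ {u v}, G.Adj u v → l v ≤ l u + 1
  parent : ∀ {v n}, l v = n + 1 → ∃ p, G.Adj p v ∧ l p = n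
  clique : ∀ {x p q}, G.Adj p x → G.Adj q x → l x = l p + 1 → l x = l q + 1 → p ≠ q → G.Adj p q
  same : ∀ {x y p}, G.Adj x y → l x = l y → G.Adj p x → l x = l p + 1 → G.Adj p y
  not_flat : ∀ {a b c d}, IsInducedP4 G a b c d → l a = l b → l b = l c → l c ≠ l d

namespace IsPtolemaic

variable {V : Type*} {G : SimpleGraph V}

theorem dist_adj_le (hc : G.Connected) (r : V) {u v : V} (h : G.Adj u v) :
    G.dist r v ≤ G.dist r u + 1 := by
  have h1 := hc.dist_triangle (u := r) (v := u) (w := v)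
  rwa [SimpleGraph.dist_eq_one_iff_adj.2 h] at h1

theorem exists_dist_parent (hc : G.Connected) (r : V) {v : V} {n : ℕ} (h : G.dist r v = n + 1) :
    ∃ p, G.Adj p v ∧ G.dist r p = n := by
  obtain ⟨w, hw⟩ := hc.exists_walk_length_eq_dist r v
  have hlen : w.length = n + 1 := hw.trans h
  have hadj := w.adj_getVert_succ (i := n) (by omega)
  rw [← hlen, w.getVert_length] at hadj
  refine ⟨_, hadj, ?_⟩
  have h1 := SimpleGraph.dist_le (w.take n)
  rw [SimpleGraph.Walk.take_length] at h1
  have h2 := dist_adj_le hc r hadj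
  omega

theorem reachable_of_low_levels (hc : G.Connected) (r : V) {N : ℕ} {S : V → Prop}
    (hS : ∀ v, G.dist r v + 2 ≤ N → S v) {p : V} (hp : G.dist r p + 1 = N) (hSp : S p) :
    (restrict G S).Reachable r p := by
  have low : ∀ n, n + 2 ≤ N → ∀ v, G.dist r v = n → (restrict G S).Reachable r v := by
    intro n
    induction n with
    | zero =>
      intro _ v hv
      rw [hc.dist_eq_zero_iff] at hv
      rw [hv]
    | succ n ih =>
      intro hn v hv
      obtain ⟨u, huv, hu⟩ := exists_dist_parent hc r hv
      have : (restrict G S).Adj u v := ⟨huv, hS _ (by omega), hS _ (by omega)⟩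
      exact (ih (by omega) u hu).trans this.reachable
  rcases Nat.eq_zero_or_pos (G.dist r p) with h | h
  · rw [hc.dist_eq_zero_iff] at h
    rw [h]
  · obtain ⟨m, hm⟩ : ∃ m, G.dist r p = m + 1 := ⟨_, (Nat.succ_pred_eq_of_pos h).symm⟩
    obtain ⟨u, hup, hu⟩ := exists_dist_parent hc r hm
    have : (restrict G S).Adj u p := ⟨hup, hS _ (by omega), hSp⟩
    exact (low m (by omega) u hu).trans this.reachable

theorem dist_parents_adj (hG : IsPtolemaic G) (hc : G.Connected) (r : V) {x p q : V}
    (hp : G.Adj p x) (hq : G.Adj q x) (lp : G.dist r x = G.dist r p + 1)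
    (lq : G.dist r x = G.dist r q + 1) (hne : p ≠ q) : G.Adj p q := by
  by_contra hn
  set S : V → Prop := fun v => v = p ∨ v = q ∨ G.dist r v + 2 ≤ G.dist r x with hSdef
  refine hG.not_reachable hp.symm hq.symm hne hn S ?_ ?_ ?_
  · rintro v (h | h | h) h1 h2
    · exact absurd h h1
    · exact absurd h h2
    · refine ⟨by rintro rfl; omega, fun h3 => ?_⟩
      have := dist_adj_le hc r h3.symm
      omega
  · rintro (h | h | h)
    · exact G.irrefl (h ▸ hp)
    · exact G.irrefl (h ▸ hq)
    · omega
  · have hS : ∀ v, G.dist r v + 2 ≤ G.dist r x → S v := fun v h => Or.inr (Or.inr h)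
    exact (reachable_of_low_levels hc r hS lp.symm (Or.inl rfl)).symm.trans
      (reachable_of_low_levels hc r hS lq.symm (Or.inr (Or.inl rfl)))

theorem dist_same_parents (hG : IsPtolemaic G) (hc : G.Connected) (r : V) (n : ℕ) :
    ∀ {x y p : V}, G.dist r x = n → G.Adj x y → G.dist r x = G.dist r y → G.Adj p x →
      G.dist r x = G.dist r p + 1 → G.Adj p y := by
  induction n using Nat.strong_induction_on with
  | _ n ih =>
  intro x y p hn hxy hl hpx lp
  by_contra hpy
  have npy : p ≠ y := by rintro rfl; omega
  obtain ⟨q, hqy, lq⟩ := exists_dist_parent hc r (v := y) (n := G.dist r p) (by omega)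
  have npq : p ≠ q := by rintro rfl; exact hpy hqy
  by_cases hqx : G.Adj q x
  · have hpq := hG.dist_parents_adj hc r hpx hqx lp (by omega) npq
    rcases Nat.eq_zero_or_pos (G.dist r p) with h | h
    · have h' : G.dist r q = 0 := by omega
      rw [hc.dist_eq_zero_iff] at h h'
      exact npq (h.symm.trans h')
    · obtain ⟨m, hm⟩ : ∃ m, G.dist r p = m + 1 := ⟨_, (Nat.succ_pred_eq_of_pos h).symm⟩
      obtain ⟨w, hwp, lw⟩ := exists_dist_parent hc r hm
      have hwq : G.Adj w q := ih _ (by omega) rfl hpq (by omega) hwp (by omega)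
      have far : ∀ {v}, G.dist r v = m + 2 → ¬ G.Adj w v := by
        intro v hv h
        have := dist_adj_le hc r h
        omega
      exact hG.gem_free ⟨⟨by rintro rfl; omega, by rintro rfl; omega, npy⟩, ⟨hwp, hpx, hxy⟩,
        far (by omega), far (by omega), hpy⟩ hwq.symm hpq.symm hqx hqy
  · set S : V → Prop := fun v => v = p ∨ v = y ∨ v = q ∨ G.dist r v + 2 ≤ G.dist r x with hSdef
    refine hG.not_reachable hpx.symm hxy npy hpy S ?_ ?_ ?_
    · rintro v (h | h | h | h) h1 h2
      · exact absurd h h1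
      · exact absurd h h2
      · subst h
        exact ⟨by rintro rfl; omega, fun h => hqx h.symm⟩
      · refine ⟨by rintro rfl; omega, fun h3 => ?_⟩
        have := dist_adj_le hc r h3.symm
        omega
    · rintro (h | h | h | h)
      · exact G.irrefl (h ▸ hpx)
      · exact G.irrefl (h ▸ hxy)
      · subst h; omega
      · omega
    · have hS : ∀ v, G.dist r v + 2 ≤ G.dist r x → S v := fun v h => Or.inr (Or.inr (Or.inr h))
      have h1 := reachable_of_low_levels hc r hS lp.symm (Or.inl rfl)
      have h2 := reachable_of_low_levels hc r hS (p := q) (by omega) (Or.inr (Or.inr (Or.inl rfl)))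
      have h3 : (restrict G S).Adj q y := ⟨hqy, by simp [hSdef], by simp [hSdef]⟩
      exact h1.symm.trans (h2.trans h3.reachable)

theorem isLayering_dist (hG : IsPtolemaic G) (hc : G.Connected) (r : V) :
    IsLayering G (G.dist r) where
  zero := fun hu hv => by
    rw [hc.dist_eq_zero_iff] at hu hv
    exact hu.symm.trans hv
  le := dist_adj_le hc r
  parent := exists_dist_parent hc r
  clique := hG.dist_parents_adj hc r
  same := hG.dist_same_parents hc r _ rfl
  not_flat := by
    intro a b c d h h1 h2 h3
    rcases Nat.eq_zero_or_pos (G.dist r a) with h0 | h0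
    · have h0' : G.dist r b = 0 := by omega
      rw [hc.dist_eq_zero_iff] at h0 h0'
      exact G.irrefl (h0 ▸ h0' ▸ h.2.1.1)
    · obtain ⟨m, hm⟩ : ∃ m, G.dist r a = m + 1 := ⟨_, (Nat.succ_pred_eq_of_pos h0).symm⟩
      obtain ⟨p, hpa, lp⟩ := exists_dist_parent hc r hm
      have hpb := hG.dist_same_parents hc r _ rfl h.2.1.1 h1 hpa (by omega)
      have hpc := hG.dist_same_parents hc r _ rfl h.2.1.2.1 h2 hpb (by omega)
      have hpd := hG.dist_same_parents hc r _ rfl h.2.1.2.2 h3 hpc (by omega)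
      exact hG.gem_free h hpa hpb hpc hpd

end IsPtolemaic

/-- The possible sequences of levels along an induced `P₄`, up to reversal. -/
inductive LevelPattern {V : Type*} (l : V → ℕ) (a b c d : V) : Prop
  | monotone (hb : l b = l a + 1) (hc : l c = l a + 2) (hd : l d = l a + 3)
  | trough (ha : l a = l b + 1) (hc : l c = l b) (hd : l d = l b + 1)
  | vee (ha : l a = l b + 1) (hc : l c = l b + 1) (hd : l d = l b + 2)
  | hook (ha : l a = l b) (hc : l c = l b + 1) (hd : l d = l b + 2)
  | step (ha : l a = l b) (hc : l c = l b) (hd : l d = l b + 1)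

theorem IsLayering.levelPattern {V : Type*} {G : SimpleGraph V} {l : V → ℕ} (hl : IsLayering G l)
    {a b c d : V} (h : IsInducedP4 G a b c d) :
    LevelPattern l a b c d ∨ LevelPattern l d c b a := by
  -- it suffices to treat the paths whose middle edge does not descend
  have key : ∀ {a b c d : V}, IsInducedP4 G a b c d → l b ≤ l c →
      LevelPattern l a b c d ∨ LevelPattern l d c b a := by
    intro a b c d h hbc
    obtain ⟨⟨n1, n2, n3⟩, ⟨h1, h2, h3⟩, h4, h5, h6⟩ := h
    have e1 := hl.le h1
    have e1' := hl.le h1.symm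
    have e2 := hl.le h2
    have e3 := hl.le h3
    have e3' := hl.le h3.symm
    have ha : l b = l a + 1 → l b ≠ l c := fun e e' => h4 (hl.same h2 e' h1 e)
    have hd : l c = l d + 1 → l b ≠ l c := fun e e' => h6 (hl.same h2.symm e'.symm h3.symm e).symm
    rcases Nat.lt_or_ge (l b) (l c) with hlt | hge
    · have hd1 : l c ≠ l d := fun e => h6 (hl.same h3 e h2 (by omega))
      have hd2 : l c ≠ l d + 1 := fun e => h6 (hl.clique h2 h3.symm (by omega) e n3)
      left
      rcases Nat.lt_trichotomy (l a) (l b) with e | e | e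
      · exact .monotone (by omega) (by omega) (by omega)
      · exact .hook (by omega) (by omega) (by omega)
      · exact .vee (by omega) (by omega) (by omega)
    · have hbc' : l b = l c := by omega
      have ha' : l b ≠ l a + 1 := fun e => ha e hbc'
      have hd' : l c ≠ l d + 1 := fun e => hd e hbc'
      have hflat : l a = l b → l c ≠ l d := fun e =>
        hl.not_flat ⟨⟨n1, n2, n3⟩, ⟨h1, h2, h3⟩, h4, h5, h6⟩ e hbc'
      by_cases ea : l a = l b
      · exact Or.inl (.step (by omega) (by omega) (by have := hflat ea; omega))
      · by_cases ed : l c = l d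
        · exact Or.inr (.step (by omega) (by omega) (by omega))
        · exact Or.inl (.trough (by omega) (by omega) (by omega))
  rcases le_total (l b) (l c) with e | e
  · exact key h e
  · exact (key h.reverse e).symm

/-! ### Rankings -/

/-- The end-edges of every induced `P₄` are both ascending or both descending, towards the middle,
with respect to `f`. -/
def IsOppositionRanking {V α : Type*} [LT α] (G : SimpleGraph V) (f : V → α) : Prop :=
  ∀ a b c d, IsInducedP4 G a b c d → (f a < f b ∧ f d < f c) ∨ (f b < f a ∧ f c < f d)

/-- An opposition ranking by natural numbers. Orienting every edge towards its larger end, with ties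
broken by an arbitrary linear order, turns it into an acyclic orientation. -/
def HasOppositionRanking {V : Type*} (G : SimpleGraph V) : Prop :=
  ∃ f : V → ℕ, IsOppositionRanking G f

theorem IsOppositionRanking.hasOppositionRanking {V α : Type*} [Finite V] [LinearOrder α]
    {G : SimpleGraph V} {f : V → α} (hf : IsOppositionRanking G f) : HasOppositionRanking G := by
  have key : ∀ u v, f u < f v → {w | f w < f u}.ncard < {w | f w < f v}.ncard := by
    intro u v huv
    refine Set.ncard_lt_ncard ⟨fun w hw => lt_trans hw huv, fun h => ?_⟩ (Set.toFinite _)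
    exact lt_irrefl _ (h huv)
  refine ⟨fun v => {w | f w < f v}.ncard, fun a b c d h => ?_⟩
  rcases hf a b c d h with h | h
  · exact Or.inl ⟨key _ _ h.1, key _ _ h.2⟩
  · exact Or.inr ⟨key _ _ h.1, key _ _ h.2⟩

theorem HasOppositionRanking.isOppositionGraph {V : Type*} [Finite V] {G : SimpleGraph V}
    (h : HasOppositionRanking G) : IsOppositionGraph G := by
  obtain ⟨f, hf⟩ := h
  obtain ⟨n, ⟨e⟩⟩ := Finite.exists_equiv_fin V
  set g : V → ℕ ×ₗ Fin n := fun v => toLex (f v, e v) with hg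
  have ginj : Function.Injective g := fun u v huv => by
    have := congrArg (fun z => (ofLex z).2) huv
    exact e.injective this
  have glt : ∀ {u v}, f u < f v → g u < g v := fun h => Prod.Lex.toLex_lt_toLex.2 (Or.inl h)
  refine ⟨fun u v => G.Adj u v ∧ g u < g v, ⟨fun x y h => h.1, fun x y h => ?_⟩, ?_, ?_⟩
  · rcases lt_trichotomy (g x) (g y) with h' | h' | h'
    · exact Or.inl ⟨⟨h, h'⟩, fun h'' => lt_asymm h' h''.2⟩
    · exact absurd (ginj h') h.ne
    · exact Or.inr ⟨⟨h.symm, h'⟩, fun h'' => lt_asymm h' h''.2⟩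
  · have : ∀ u v, Relation.TransGen (fun u v => G.Adj u v ∧ g u < g v) u v → g u < g v := by
      intro u v h
      induction h with
      | single h => exact h.2
      | tail _ h ih => exact ih.trans h.2
    exact fun x hx => lt_irrefl _ (this x x hx)
  · intro a b c d h
    have h1 := h.2.1.1
    have h3 := h.2.1.2.2
    rcases hf a b c d h with h' | h'
    · exact Or.inl ⟨⟨h1, glt h'.1⟩, h3.symm, glt h'.2⟩
    · exact Or.inr ⟨⟨h1.symm, glt h'.1⟩, h3, glt h'.2⟩

/-! ### The ranking given by a good root -/

/-- The level folded with period four onto `0, 1, 2, 1`. -/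
def fold (n : ℕ) : ℕ := if n % 4 = 3 then 1 else n % 4

/-- The sign that governs the order inside the level `n`. -/
def levelSign (n : ℕ) : ℤ := if n % 4 = 1 ∨ n % 4 = 2 then 1 else -1

/-- The children of `v` that have children themselves. -/
def deepChildren {V : Type*} (G : SimpleGraph V) (l : V → ℕ) (v : V) : Set V :=
  {e | G.Adj v e ∧ l e = l v + 1 ∧ ∃ f, G.Adj e f ∧ l f = l e + 1}

/-- The closed neighbourhood of `v` inside its level. -/
def levelNeighbors {V : Type*} (G : SimpleGraph V) (l : V → ℕ) (v : V) : Set V :=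
  {u | l u = l v ∧ (u = v ∨ G.Adj v u)}

/-- Ranks vertices by the folded level, shifted by `ε`, then by the number of deep children, then
by the number of neighbours in the level; the sign depends on the level. -/
noncomputable def levelRank {V : Type*} (G : SimpleGraph V) (l : V → ℕ) (ε : ℕ) (v : V) :
    ℕ ×ₗ ℤ ×ₗ ℤ :=
  toLex (fold (l v + ε), toLex (levelSign (l v + ε) * (deepChildren G l v).ncard,
    -(levelSign (l v + ε) * (levelNeighbors G l v).ncard)))

/-- The conditions under which `levelRank` is an opposition ranking. -/
structure IsGoodLayering {V : Type*} (G : SimpleGraph V) (l : V → ℕ) (ε : ℕ) : Prop where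
  vee : ∀ {a b c d}, IsInducedP4 G a b c d → l a = l b + 1 → l c = l b + 1 → l d = l b + 2 →
    Even (l b + ε)
  comparable : ∀ {a b}, G.Adj a b → l a = l b →
    deepChildren G l a ⊆ deepChildren G l b ∨ deepChildren G l b ⊆ deepChildren G l a
  not_clash : ∀ {a b c d e f}, ¬ Even (l b + ε) → G.Adj a b → G.Adj b c → ¬ G.Adj a c → a ≠ c →
    l a = l b → l c = l b → G.Adj c d → l d = l b + 1 → ¬ G.Adj b d → G.Adj b e → l e = l b + 1 →
    ¬ G.Adj a e → ¬ G.Adj c e → G.Adj e f → l f = l b + 2 → False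

theorem levelRank_lt_of_fold {V : Type*} {G : SimpleGraph V} {l : V → ℕ} {ε : ℕ} {u v : V}
    (h : fold (l u + ε) < fold (l v + ε)) : levelRank G l ε u < levelRank G l ε v :=
  Prod.Lex.toLex_lt_toLex.2 (Or.inl h)

theorem levelRank_lt_of_deepChildren {V : Type*} {G : SimpleGraph V} {l : V → ℕ} {ε : ℕ} {u v : V}
    (huv : l u = l v) (h : levelSign (l v + ε) * (deepChildren G l u).ncard <
      levelSign (l v + ε) * (deepChildren G l v).ncard) :
    levelRank G l ε u < levelRank G l ε v := by
  refine Prod.Lex.toLex_lt_toLex.2 (Or.inr ⟨by rw [huv], ?_⟩)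
  refine Prod.Lex.toLex_lt_toLex.2 (Or.inl ?_)
  simpa only [huv] using h

theorem levelRank_lt_of_levelNeighbors {V : Type*} {G : SimpleGraph V} {l : V → ℕ} {ε : ℕ}
    {u v : V} (huv : l u = l v) (h : levelSign (l v + ε) * (deepChildren G l u).ncard ≤
      levelSign (l v + ε) * (deepChildren G l v).ncard)
    (h' : levelSign (l v + ε) * (levelNeighbors G l v).ncard <
      levelSign (l v + ε) * (levelNeighbors G l u).ncard) :
    levelRank G l ε u < levelRank G l ε v := by
  rcases h.lt_or_eq with h | h
  · exact levelRank_lt_of_deepChildren huv h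
  refine Prod.Lex.toLex_lt_toLex.2 (Or.inr ⟨by rw [huv], ?_⟩)
  refine Prod.Lex.toLex_lt_toLex.2 (Or.inr ⟨by simpa only [huv] using h, ?_⟩)
  simpa only [huv] using neg_lt_neg h'

theorem levelSign_fold (n : ℕ) : (levelSign n = 1 ∧ fold (n + 2) < fold (n + 1)) ∨
    (levelSign n = -1 ∧ fold (n + 1) < fold (n + 2)) := by
  unfold levelSign fold
  have : n % 4 < 4 := Nat.mod_lt _ (by norm_num)
  split_ifs <;> simp <;> omega

theorem levelSign_fold_of_odd {n : ℕ} (hn : ¬ Even n) :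
    (levelSign n = 1 ∧ fold n < fold (n + 1)) ∨ (levelSign n = -1 ∧ fold (n + 1) < fold n) := by
  rw [Nat.even_iff] at hn
  unfold levelSign fold
  split_ifs <;> simp <;> omega

namespace IsGoodLayering

variable {V : Type*} {G : SimpleGraph V} {l : V → ℕ} {ε : ℕ} {a b c d : V}

theorem deepChildren_ncard_lt [Finite V] (h : IsGoodLayering G l ε) (hP : IsInducedP4 G a b c d)
    (ha : l a = l b) (hc : l c = l b + 1) (hd : l d = l b + 2) :
    (deepChildren G l a).ncard < (deepChildren G l b).ncard := by
  obtain ⟨-, ⟨h1, h2, h3⟩, h4, -, -⟩ := hP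
  have hcb : c ∈ deepChildren G l b := ⟨h2, hc, d, h3, by omega⟩
  have hca : c ∉ deepChildren G l a := fun h => h4 h.1
  refine Set.ncard_lt_ncard ⟨?_, fun h => hca (h hcb)⟩ (Set.toFinite _)
  rcases h.comparable h1 ha with h | h
  · exact h
  · exact absurd (h hcb) hca

theorem odd_of_step (hl : IsLayering G l) (h : IsGoodLayering G l ε)
    (hP : IsInducedP4 G a b c d) (ha : l a = l b) (hc : l c = l b) (hd : l d = l b + 1) :
    ¬ Even (l b + ε) := by
  obtain ⟨⟨n1, n2, n3⟩, ⟨h1, h2, h3⟩, h4, h5, h6⟩ := hP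
  have hb : l b ≠ 0 := fun e => h1.ne (hl.zero (ha.trans e) e)
  obtain ⟨m, hm⟩ := Nat.exists_eq_succ_of_ne_zero hb
  obtain ⟨p, hpb, lp⟩ := hl.parent hm
  -- otherwise a common parent `p` of `a`, `b`, `c` would be the bottom of a forbidden `vee`
  have hpa := hl.same h1.symm ha.symm hpb (by omega)
  have hpc := hl.same h2 hc.symm hpb (by omega)
  have hpd : ¬ G.Adj p d := fun h => by have := hl.le h; omega
  have := h.vee (a := a) (b := p) (c := c) (d := d)
    ⟨⟨n1, n2, by rintro rfl; omega⟩, ⟨hpa.symm, hpc, h3⟩, h4, h5, hpd⟩ (by omega) (by omega)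
    (by omega)
  rw [Nat.even_iff] at this ⊢
  omega

theorem deepChildren_subset_of_step (hl : IsLayering G l) (h : IsGoodLayering G l ε)
    (hP : IsInducedP4 G a b c d) (ha : l a = l b) (hc : l c = l b) (hd : l d = l b + 1) :
    deepChildren G l b ⊆ deepChildren G l a := by
  have hodd := odd_of_step hl h hP ha hc hd
  obtain ⟨⟨n1, n2, n3⟩, ⟨h1, h2, h3⟩, h4, h5, h6⟩ := hP
  rintro e ⟨hbe, le, f, hef, lf⟩
  by_contra hea
  have hae : ¬ G.Adj a e := fun h => hea ⟨h, by omega, f, hef, lf⟩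
  by_cases hce : G.Adj c e
  · -- `d c e f` would be a forbidden `vee`
    have hde : ¬ G.Adj d e := fun h => h6 (hl.same h.symm (by omega) hbe (by omega))
    have nde : d ≠ e := by rintro rfl; exact h6 hbe
    have hcf : ¬ G.Adj c f := fun h => by have := hl.le h; omega
    have hdf : ¬ G.Adj d f := fun h => hde (hl.clique h hef (by omega) (by omega) nde)
    have := h.vee (a := d) (b := c) (c := e) (d := f)
      ⟨⟨nde, by rintro rfl; omega, by rintro rfl; omega⟩, ⟨h3.symm, hce, hef⟩, hde, hdf, hcf⟩
      (by omega) (by omega) (by omega)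
    rw [hc] at this
    exact hodd this
  · exact h.not_clash hodd h1 h2 h4 n1 ha hc h3 hd h6 hbe le hae hce hef (by omega)

theorem levelNeighbors_ncard_lt [Finite V] (hG : IsPtolemaic G) (hl : IsLayering G l)
    (hP : IsInducedP4 G a b c d) (ha : l a = l b) (hc : l c = l b) :
    (levelNeighbors G l a).ncard < (levelNeighbors G l b).ncard := by
  obtain ⟨⟨n1, n2, n3⟩, ⟨h1, h2, h3⟩, h4, h5, h6⟩ := hP
  refine Set.ncard_lt_ncard ⟨?_, fun h => ?_⟩ (Set.toFinite _)
  · rintro u ⟨lu, rfl | hau⟩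
    · exact ⟨ha, Or.inr h1.symm⟩
    · refine ⟨by omega, ?_⟩
      by_contra! hub
      have nuc : u ≠ c := by rintro rfl; exact h4 hau
      have huc := hG.not_adj_ends hau.symm h1 h2 (fun h => hub.2 h.symm) h4 hub.1 n1
      exact hl.not_flat ⟨⟨hub.1, nuc, n1⟩, ⟨hau.symm, h1, h2⟩, fun h => hub.2 h.symm, huc, h4⟩ lu ha
        hc.symm
  · rcases (h ⟨hc, Or.inr h2⟩).2 with h | h
    · exact n1 h.symm
    · exact h4 h

theorem isOppositionRanking [Finite V] (hG : IsPtolemaic G) (hl : IsLayering G l)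
    (h : IsGoodLayering G l ε) : IsOppositionRanking G (levelRank G l ε) := by
  have key : ∀ a b c d, IsInducedP4 G a b c d → LevelPattern l a b c d →
      (levelRank G l ε a < levelRank G l ε b ∧ levelRank G l ε d < levelRank G l ε c) ∨
      (levelRank G l ε b < levelRank G l ε a ∧ levelRank G l ε c < levelRank G l ε d) := by
    intro a b c d hP hpat
    -- the folded levels decide all patterns except those with a horizontal end-edge
    have byFold : ((fold (l a + ε) < fold (l b + ε) ∧ fold (l d + ε) < fold (l c + ε)) ∨
        (fold (l b + ε) < fold (l a + ε) ∧ fold (l c + ε) < fold (l d + ε))) →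
        (levelRank G l ε a < levelRank G l ε b ∧ levelRank G l ε d < levelRank G l ε c) ∨
        (levelRank G l ε b < levelRank G l ε a ∧ levelRank G l ε c < levelRank G l ε d) := by
      rintro (h | h)
      · exact Or.inl ⟨levelRank_lt_of_fold h.1, levelRank_lt_of_fold h.2⟩
      · exact Or.inr ⟨levelRank_lt_of_fold h.1, levelRank_lt_of_fold h.2⟩
    rcases hpat with ⟨hb, hc, hd⟩ | ⟨ha, hc, hd⟩ | ⟨ha, hc, hd⟩ | ⟨ha, hc, hd⟩ | ⟨ha, hc, hd⟩
    · refine byFold ?_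
      unfold fold
      split_ifs <;> omega
    · refine byFold ?_
      unfold fold
      split_ifs <;> omega
    · have := h.vee hP ha hc hd
      rw [Nat.even_iff] at this
      refine byFold ?_
      unfold fold
      split_ifs <;> omega
    · have hlt := h.deepChildren_ncard_lt hP ha hc hd
      have e1 : l c + ε = l b + ε + 1 := by omega
      have e2 : l d + ε = l b + ε + 2 := by omega
      rcases levelSign_fold (l b + ε) with ⟨s, hf⟩ | ⟨s, hf⟩
      · left
        refine ⟨levelRank_lt_of_deepChildren ha ?_, levelRank_lt_of_fold (by rwa [e1, e2])⟩
        rw [s]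
        omega
      · right
        refine ⟨levelRank_lt_of_deepChildren ha.symm ?_, levelRank_lt_of_fold (by rwa [e1, e2])⟩
        rw [ha, s]
        omega
    · have hodd := odd_of_step hl h hP ha hc hd
      have hsub := Set.ncard_le_ncard (deepChildren_subset_of_step hl h hP ha hc hd)
        (Set.toFinite _)
      have hlt := levelNeighbors_ncard_lt hG hl hP ha hc
      have e1 : l d + ε = l b + ε + 1 := by omega
      rcases levelSign_fold_of_odd hodd with ⟨s, hf⟩ | ⟨s, hf⟩
      · right
        refine ⟨levelRank_lt_of_levelNeighbors ha.symm ?_ ?_,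
          levelRank_lt_of_fold (by rwa [e1, hc])⟩
        · rw [ha, s]; omega
        · rw [ha, s]; omega
      · left
        refine ⟨levelRank_lt_of_levelNeighbors ha ?_ ?_, levelRank_lt_of_fold (by rwa [e1, hc])⟩
        · rw [s]; omega
        · rw [s]; omega
  intro a b c d hP
  rcases hl.levelPattern hP with h | h
  · exact key a b c d hP h
  · rcases key d c b a hP.reverse h with h | h
    · exact Or.inl h.symm
    · exact Or.inr h.symm

end IsGoodLayering

/-! ### The trees `T_k` in a layering -/

theorem graphT_isIndContained {V : Type*} {G : SimpleGraph V} {l : V → ℕ} (hl : IsLayering G l)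
    {k : ℕ} (hk : 1 ≤ k) {q : ℕ → V} (hq : ∀ n ≤ 2 * k + 1, l (q n) = n)
    (hqq : ∀ n < 2 * k + 1, G.Adj (q n) (q (n + 1)))
    {a : V} (ha : G.Adj a (q (2 * k - 1))) (la : l a = 2 * k) (hna : a ≠ q (2 * k))
    (ha1 : ¬ G.Adj a (q (2 * k))) (ha2 : ¬ G.Adj a (q (2 * k + 1)))
    {x y x' : V} (hx : G.Adj (q 0) x) (hx' : G.Adj (q 0) x') (hxy : G.Adj x y) (lx : l x = 1)
    (lx' : l x' = 1) (ly : l y = 2) (nxx' : x ≠ x') (hxx' : ¬ G.Adj x x') (nx : x ≠ q 1)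
    (nx' : x' ≠ q 1) (hx1 : ¬ G.Adj x (q 1)) (hx'1 : ¬ G.Adj x' (q 1)) :
    (graphT k).IsIndContained G := by
  have far : ∀ {u v}, l u + 2 ≤ l v → ¬ G.Adj u v := fun h h' => by have := hl.le h'; omega
  have far' : ∀ {u v}, l v + 2 ≤ l u → ¬ G.Adj u v := fun h h' => far h h'.symm
  have h12 : G.Adj (q 1) (q 2) := hqq 1 (by omega)
  have h23 : G.Adj (q 2) (q 3) := hqq 2 (by omega)
  have l1 := hq 1 (by omega)
  have l2 := hq 2 (by omega)
  have l3 := hq 3 (by omega)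
  have qq : ∀ m n, m < n → n ≤ 2 * k + 1 → (G.Adj (q m) (q n) ↔ m + 1 = n) := by
    intro m n hmn hn
    have e1 := hq m (by omega)
    have e2 := hq n hn
    constructor
    · intro h
      have := hl.le h
      omega
    · rintro rfl
      exact hqq m (by omega)
  have nqq : ∀ m n, m < n → n ≤ 2 * k + 1 → q m ≠ q n := by
    intro m n hmn hn h
    have e1 := hq m (by omega)
    have e2 := hq n hn
    rw [h] at e1
    omega
  -- a neighbour of the root off the closed neighbourhood of `q 1` sees no other vertex of the path
  have off : ∀ x, G.Adj (q 0) x → l x = 1 → x ≠ q 1 → ¬ G.Adj x (q 1) → ∀ n ≤ 2 * k + 1,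
      x ≠ q n ∧ (G.Adj x (q n) ↔ n = 0) := by
    intro x hx lx nx hx1 n hn
    have e := hq n hn
    refine ⟨?_, ?_⟩
    · rintro rfl
      have : n = 1 := by omega
      subst this
      exact nx rfl
    constructor
    · intro h
      have := hl.le h
      have hcases : n = 0 ∨ n = 1 ∨ n = 2 := by omega
      rcases hcases with rfl | rfl | rfl
      · rfl
      · exact absurd h hx1
      · exact absurd (hl.clique h h12 (by omega) (by omega) nx) hx1
    · rintro rfl
      exact hx.symm
  have xq := off x hx lx nx hx1
  have x'q := off x' hx' lx' nx' hx'1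
  have hx2 : ¬ G.Adj x (q 2) := fun h => by simpa using ((xq 2 (by omega)).2.1 h)
  have ny2 : y ≠ q 2 := by rintro rfl; exact hx2 hxy
  have hy2 : ¬ G.Adj y (q 2) := fun h => hx2 (hl.same h (by omega) hxy (by omega))
  have yq : ∀ n ≤ 2 * k + 1, y ≠ q n ∧ ¬ G.Adj y (q n) := by
    intro n hn
    have e := hq n hn
    have hcases : n = 0 ∨ n = 1 ∨ n = 2 ∨ n = 3 ∨ 4 ≤ n := by omega
    rcases hcases with rfl | rfl | rfl | rfl | h
    · exact ⟨by rintro rfl; omega, far' (by omega)⟩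
    · exact ⟨by rintro rfl; omega,
        fun h => hx1 (hl.clique hxy h.symm (by omega) (by omega) nx)⟩
    · exact ⟨ny2, hy2⟩
    · exact ⟨by rintro rfl; omega, fun h => hy2 (hl.clique h h23 (by omega) (by omega) ny2)⟩
    · exact ⟨by rintro rfl; omega, far (by omega)⟩
  have aq : ∀ n ≤ 2 * k + 1, q n ≠ a ∧ (G.Adj (q n) a ↔ n = 2 * k - 1) := by
    intro n hn
    have e := hq n hn
    refine ⟨?_, ?_⟩
    · rintro rfl
      have : n = 2 * k := by omega
      subst this
      exact hna rfl
    constructor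
    · intro h
      have h1 := hl.le h
      have h2 := hl.le h.symm
      by_contra hne
      have hcases : n = 2 * k ∨ n = 2 * k + 1 := by omega
      rcases hcases with rfl | rfl
      · exact ha1 h.symm
      · exact ha2 h.symm
    · rintro rfl
      exact ha.symm
  have xa : ∀ x, l x = 1 → x ≠ q 1 → ¬ G.Adj x (q 1) → x ≠ a ∧ ¬ G.Adj x a := by
    intro x lx nx hx1
    refine ⟨by rintro rfl; omega, fun h => ?_⟩
    have := hl.le h
    have hk1 : k = 1 := by omega
    subst hk1
    exact hx1 (hl.clique h ha.symm (by omega) (by omega) nx)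
  have ya : y ≠ a ∧ ¬ G.Adj y a := by
    have hxa := (xa x lx nx hx1).2
    refine ⟨by rintro rfl; exact hxa hxy, fun h => ?_⟩
    have h1 := hl.le h
    have h2 := hl.le h.symm
    exact hxa (hl.same h (by omega) hxy (by omega))
  have yx' : y ≠ x' ∧ ¬ G.Adj y x' :=
    ⟨by rintro rfl; omega, fun h => hxx' (hl.clique hxy h.symm (by omega) (by omega) nxx')⟩
  set ψ : ℕ → V := fun n => if n = 0 then y else if n = 1 then x else
    if n ≤ 2 * k + 3 then q (n - 2) else if n = 2 * k + 4 then x' else a with hψ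
  have ψ0 : ψ 0 = y := by simp [hψ]
  have ψ1 : ψ 1 = x := by simp [hψ]
  have ψq : ∀ n ≤ 2 * k + 1, ψ (n + 2) = q n := by
    intro n hn
    simp [hψ, show n + 2 ≤ 2 * k + 3 by omega]
  have ψx' : ψ (2 * k + 4) = x' := by simp [hψ]
  have ψa : ψ (2 * k + 5) = a := by simp [hψ]
  have key : ∀ m n, m < n → n < 2 * k + 6 → ψ m ≠ ψ n ∧ (G.Adj (ψ m) (ψ n) ↔
      (m + 1 = n ∧ n ≤ 2 * k + 3) ∨ (m = 2 ∧ n = 2 * k + 4) ∨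
        (m = 2 * k + 1 ∧ n = 2 * k + 5)) := by
    intro m n hmn hn
    have hm' : m = 0 ∨ m = 1 ∨ (∃ i ≤ 2 * k + 1, m = i + 2) ∨ m = 2 * k + 4 := by
      by_cases h : 2 ≤ m ∧ m ≤ 2 * k + 3
      · exact Or.inr (Or.inr (Or.inl ⟨m - 2, by omega, by omega⟩))
      · omega
    have hn' : n = 1 ∨ (∃ i ≤ 2 * k + 1, n = i + 2) ∨ n = 2 * k + 4 ∨ n = 2 * k + 5 := by
      by_cases h : 2 ≤ n ∧ n ≤ 2 * k + 3
      · exact Or.inr (Or.inl ⟨n - 2, by omega, by omega⟩)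
      · omega
    rcases hm' with rfl | rfl | ⟨i, hi, rfl⟩ | rfl
    · rcases hn' with rfl | ⟨j, hj, rfl⟩ | rfl | rfl
      · rw [ψ0, ψ1]
        exact ⟨hxy.ne', iff_of_true hxy.symm (by omega)⟩
      · rw [ψ0, ψq j hj]
        exact ⟨(yq j hj).1, iff_of_false (yq j hj).2 (by omega)⟩
      · rw [ψ0, ψx']
        exact ⟨yx'.1, iff_of_false yx'.2 (by omega)⟩
      · rw [ψ0, ψa]
        exact ⟨ya.1, iff_of_false ya.2 (by omega)⟩
    · rcases hn' with rfl | ⟨j, hj, rfl⟩ | rfl | rfl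
      · omega
      · rw [ψ1, ψq j hj, (xq j hj).2]
        exact ⟨(xq j hj).1, by omega⟩
      · rw [ψ1, ψx']
        exact ⟨nxx', iff_of_false hxx' (by omega)⟩
      · rw [ψ1, ψa]
        exact ⟨(xa x lx nx hx1).1, iff_of_false (xa x lx nx hx1).2 (by omega)⟩
    · rcases hn' with rfl | ⟨j, hj, rfl⟩ | rfl | rfl
      · omega
      · rw [ψq i hi, ψq j hj, qq i j (by omega) hj]
        exact ⟨nqq i j (by omega) hj, by omega⟩
      · rw [ψq i hi, ψx', G.adj_comm, (x'q i hi).2]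
        exact ⟨(x'q i hi).1.symm, by omega⟩
      · rw [ψq i hi, ψa, (aq i hi).2]
        exact ⟨(aq i hi).1, by omega⟩
    · have : n = 2 * k + 5 := by omega
      subst this
      rw [ψx', ψa]
      exact ⟨(xa x' lx' nx' hx'1).1, iff_of_false (xa x' lx' nx' hx'1).2 (by omega)⟩
  have key' : ∀ i j : Fin (2 * k + 6), i < j → ψ i ≠ ψ j ∧
      (G.Adj (ψ i) (ψ j) ↔ (graphT k).Adj i j) := by
    intro i j hij
    have hij' : (i : ℕ) < j := hij
    obtain ⟨h1, h2⟩ := key i j hij' j.2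
    refine ⟨h1, h2.trans ?_⟩
    rw [graphT, SimpleGraph.fromRel_adj]
    have hne : i ≠ j := hij.ne
    have hj := j.2
    refine ⟨fun h => ⟨hne, Or.inl h⟩, ?_⟩
    rintro ⟨-, h | h⟩
    · exact h
    · omega
  refine isIndContained_of_injective (fun i : Fin (2 * k + 6) => ψ i) ?_ ?_
  · intro i j hij
    rcases lt_trichotomy i j with h | h | h
    · exact absurd hij (key' i j h).1
    · exact h
    · exact absurd hij.symm (key' j i h).1
  · intro i j
    rcases lt_trichotomy i j with h | h | h
    · exact (key' i j h).2
    · subst h; simp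
    · rw [G.adj_comm, (key' j i h).2, SimpleGraph.adj_comm]

/-! ### Spiders and the choice of the root -/

/-- `v x y` is an induced path on three vertices starting at `v`. -/
structure IsLeg {V : Type*} (G : SimpleGraph V) (v x y : V) : Prop where
  adj : G.Adj v x
  adj' : G.Adj x y
  nadj : ¬ G.Adj v y
  ne : v ≠ y

/-- In a chordal graph, this says that `v` is the centre of an induced spider with two legs
`x₁ y₁` and `x₂ y₂` of length two and one leg `x₃` of length one. -/
structure IsSpider {V : Type*} (G : SimpleGraph V) (v x₁ y₁ x₂ y₂ x₃ : V) : Prop where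
  leg₁ : IsLeg G v x₁ y₁
  leg₂ : IsLeg G v x₂ y₂
  adj₃ : G.Adj v x₃
  ne₁₂ : x₁ ≠ x₂
  ne₁₃ : x₁ ≠ x₃
  ne₂₃ : x₂ ≠ x₃
  nadj₁₂ : ¬ G.Adj x₁ x₂
  nadj₁₃ : ¬ G.Adj x₁ x₃
  nadj₂₃ : ¬ G.Adj x₂ x₃

/-- Connected gem-free chordal graphs without `T_k`, `G₁`, `G₂`. Such a graph has a root whose
layering is good. -/
structure IsObstructionFree {V : Type*} (G : SimpleGraph V) : Prop extends IsPtolemaic G where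
  connected : G.Connected
  not_graphT : ∀ k, 1 ≤ k → ¬ (graphT k).IsIndContained G
  not_graphG1 : ¬ graphG1.IsIndContained G
  not_graphG2 : ¬ graphG2.IsIndContained G

namespace IsLayering

variable {V : Type*} {G : SimpleGraph V} {l : V → ℕ}

theorem not_adj_of_lt (hl : IsLayering G l) {u v : V} (h : l u + 2 ≤ l v) : ¬ G.Adj u v :=
  fun h' => by have := hl.le h'; omega

theorem isLeg_down (hl : IsLayering G l) {u v w : V} (huv : G.Adj u v) (hvw : G.Adj v w)
    (hw : l w = l u + 2) : IsLeg G u v w :=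
  ⟨huv, hvw, hl.not_adj_of_lt (by omega), by rintro rfl; omega⟩

theorem isLeg_up (hl : IsLayering G l) {u v w : V} (huv : G.Adj u v) (hvw : G.Adj v w)
    (hw : l u = l w + 2) : IsLeg G u v w :=
  ⟨huv, hvw, fun h => hl.not_adj_of_lt (u := w) (v := u) (by omega) h.symm, by rintro rfl; omega⟩

theorem exists_path (hl : IsLayering G l) (n : ℕ) : ∀ v, l v = n →
    ∃ q : ℕ → V, q n = v ∧ (∀ j ≤ n, l (q j) = j) ∧ ∀ j < n, G.Adj (q j) (q (j + 1)) := by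
  induction n with
  | zero =>
    intro v hv
    exact ⟨fun _ => v, rfl, fun j hj => by rw [hv]; omega, fun j hj => by omega⟩
  | succ n ih =>
    intro v hv
    obtain ⟨p, hpv, lp⟩ := hl.parent hv
    obtain ⟨q, hqn, hq, hqq⟩ := ih p lp
    refine ⟨fun j => if j = n + 1 then v else q j, by simp, fun j hj => ?_, fun j hj => ?_⟩
    · by_cases h : j = n + 1
      · simp [h, hv]
      · simpa [h] using hq j (by omega)
    · by_cases h : j = n
      · subst h
        simpa [hqn] using hpv
      · simpa [h, show j ≠ n + 1 by omega] using hqq j (by omega)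

/-- Once an induced path ascends, it keeps ascending. -/
theorem ascend (hl : IsLayering G l) {y z w : V} (hyz : G.Adj y z) (hzw : G.Adj z w)
    (hyw : ¬ G.Adj y w) (nyw : y ≠ w) (h : l z = l y + 1) : l w = l z + 1 := by
  have h1 := hl.le hzw
  have h2 := hl.le hzw.symm
  have h3 : l z ≠ l w := fun e => hyw (hl.same hzw e hyz h)
  have h4 : l z ≠ l w + 1 := fun e => hyw (hl.clique hyz hzw.symm h e nyw)
  omega

/-- Once an induced path is horizontal, it does not descend. -/
theorem le_of_flat (hl : IsLayering G l) {y z w : V} (hyz : G.Adj y z) (hzw : G.Adj z w)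
    (hyw : ¬ G.Adj y w) (h : l y = l z) : l z ≤ l w := by
  by_contra hlt
  have h2 := hl.le hzw.symm
  exact hyw (hl.same hyz.symm h.symm hzw.symm (by omega)).symm

/-- Two adjacent vertices of the same level with incomparable sets of deep children yield two
paths of length two going down from them. -/
theorem comparable_of (hab : ∀ {a b e f e' f' : V}, G.Adj a b → l a = l b → G.Adj a e →
      ¬ G.Adj b e → l e = l a + 1 → G.Adj e f → l f = l a + 2 → G.Adj b e' → ¬ G.Adj a e' →
      l e' = l a + 1 → G.Adj e' f' → l f' = l a + 2 → False) {a b : V} (h : G.Adj a b)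
    (h' : l a = l b) :
    deepChildren G l a ⊆ deepChildren G l b ∨ deepChildren G l b ⊆ deepChildren G l a := by
  by_contra hn
  push Not at hn
  obtain ⟨h1, h2⟩ := hn
  obtain ⟨e, ⟨hae, le, f, hef, lf⟩, hbe⟩ := Set.not_subset.1 h1
  obtain ⟨e', ⟨hbe', le', f', hef', lf'⟩, hae'⟩ := Set.not_subset.1 h2
  exact hab h h' hae (fun h'' => hbe ⟨h'', by omega, f, hef, lf⟩) le hef (by omega) hbe'
    (fun h'' => hae' ⟨h'', by omega, f', hef', lf'⟩) (by omega) hef' (by omega)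

end IsLayering

namespace IsObstructionFree

variable {V : Type*} {G : SimpleGraph V}

theorem isLayering (hG : IsObstructionFree G) (r : V) : IsLayering G (G.dist r) :=
  hG.isLayering_dist hG.connected r

/-- The configuration of `graphG1_of` does not occur: a triangle each of whose vertices starts a leg
that avoids the other two vertices. -/
theorem not_triangle_legs (hG : IsObstructionFree G) {a b c a' b' c' a'' b'' c'' : V}
    (hab : G.Adj a b) (hac : G.Adj a c) (hbc : G.Adj b c) (ha : IsLeg G a a' a'')
    (hb : IsLeg G b b' b'') (hc : IsLeg G c c' c'') (hba' : ¬ G.Adj b a') (hca' : ¬ G.Adj c a')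
    (hab' : ¬ G.Adj a b') (hcb' : ¬ G.Adj c b') (hac' : ¬ G.Adj a c') (hbc' : ¬ G.Adj b c') :
    False :=
  hG.not_graphG1 (hG.graphG1_of hab hac hbc ha.adj hba' hca' hb.adj hab' hcb' hc.adj hac' hbc'
    ha.adj' ha.nadj ha.ne.symm hb.adj' hb.nadj hb.ne.symm hc.adj' hc.nadj hc.ne.symm)

/-- The configuration of `graphG2_of` does not occur: a diamond with a pendant edge at its tip `c`
and legs at the ends of its middle edge `pb`. -/
theorem not_diamond_legs (hG : IsObstructionFree G) {p b a c d p' p'' e f : V} (hpb : G.Adj p b)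
    (hpa : G.Adj p a) (hba : G.Adj b a) (hac : ¬ G.Adj a c) (nac : a ≠ c) (hpc : IsLeg G p c d)
    (hbc : IsLeg G b c d) (hp : IsLeg G p p' p'') (hbp' : ¬ G.Adj b p') (nbp' : b ≠ p')
    (hb : IsLeg G b e f) (hpe : ¬ G.Adj p e) (npe : p ≠ e) : False :=
  hG.not_graphG2 (hG.graphG2_of hpb hpa hpc.adj hba hbc.adj hac nac hpc.adj' hpc.nadj hpc.ne
    hbc.nadj hbc.ne hp.adj hbp' nbp' hp.adj' hp.nadj hp.ne hb.adj hpe npe hb.adj' hb.nadj hb.ne)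

theorem not_incomparable_of_three_le (hG : IsObstructionFree G) {l : V → ℕ} (hl : IsLayering G l)
    {a b e f e' f' : V} (h3 : 3 ≤ l a) (hab : G.Adj a b) (lab : l a = l b) (hae : G.Adj a e)
    (hbe : ¬ G.Adj b e) (le : l e = l a + 1) (hef : G.Adj e f) (lf : l f = l a + 2)
    (hbe' : G.Adj b e') (hae' : ¬ G.Adj a e') (le' : l e' = l a + 1) (hef' : G.Adj e' f')
    (lf' : l f' = l a + 2) : False := by
  obtain ⟨n, hn⟩ : ∃ n, l a = n + 3 := ⟨l a - 3, by omega⟩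
  obtain ⟨p, hpa, lp⟩ := hl.parent (v := a) (n := n + 2) (by omega)
  obtain ⟨p', hp', lp'⟩ := hl.parent lp
  obtain ⟨p'', hp'', lp''⟩ := hl.parent lp'
  have hpb := hl.same hab lab hpa (by omega)
  exact hG.not_triangle_legs hab hpa.symm hpb.symm (hl.isLeg_down hae hef lf)
    (hl.isLeg_down hbe' hef' (by omega)) (hl.isLeg_up hp'.symm hp''.symm (by omega)) hbe
    (hl.not_adj_of_lt (by omega)) hae' (hl.not_adj_of_lt (by omega))
    (fun h => hl.not_adj_of_lt (by omega) h.symm) (fun h => hl.not_adj_of_lt (by omega) h.symm)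

section Spider

variable {c x₁ y₁ x₂ y₂ x₃ : V}

/-- Two nonadjacent common neighbours `x`, `x'` of `c` and `q`, with `c x y` a leg, leave no room
for private legs of both `c` and `q`. -/
theorem not_common_leg (hG : IsObstructionFree G) {q x y x' z w e f : V} (hcq : G.Adj c q)
    (hx : IsLeg G c x y) (hx' : G.Adj c x') (nxx' : x ≠ x') (hxx' : ¬ G.Adj x x')
    (hqx : G.Adj q x) (hqx' : G.Adj q x') (hz : IsLeg G c z w) (nzq : z ≠ q) (hqz : ¬ G.Adj q z)
    (he : IsLeg G q e f) (nec : c ≠ e) (hce : ¬ G.Adj c e) : False := by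
  have hqy : ¬ G.Adj q y := fun h => hx.nadj (by
    by_contra hcy
    have := hG.not_adj_of_diamond hcq hx.adj hqx hx' hqx' nxx' hxx' h hcy hx.ne.symm
    exact this hx.adj'.symm)
  have nqy : q ≠ y := by rintro rfl; exact hx.nadj hcq
  exact hG.not_diamond_legs hcq hx' hqx' (fun h => hxx' h.symm) nxx'.symm hx
    ⟨hqx, hx.adj', hqy, nqy⟩ hz hqz nzq.symm he hce nec

/-- Let `c` be the centre of a spider with as many vertices as possible at distance at most two.
Then no two feet of the spider are in the closed neighbourhood of a neighbour `q` of `c` from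
which a path descends further. -/
theorem not_two_common [Finite V] (hG : IsObstructionFree G) (hs : IsSpider G c x₁ y₁ x₂ y₂ x₃)
    (hmax : ∀ v x₁ y₁ x₂ y₂ x₃, IsSpider G v x₁ y₁ x₂ y₂ x₃ →
      {w | G.dist v w ≤ 2}.ncard ≤ {w | G.dist c w ≤ 2}.ncard)
    {q e f : V} (hcq : G.Adj c q) (hqe : G.Adj q e) (hef : G.Adj e f) (le : G.dist c e = 2)
    (lf : G.dist c f = 3) :
    ¬ (G.Adj q x₁ ∧ G.Adj q x₂) ∧ ¬ (G.Adj q x₁ ∧ G.Adj q x₃) ∧ ¬ (G.Adj q x₂ ∧ G.Adj q x₃) := by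
  have hl := hG.isLayering c
  have lq : G.dist c q = 1 := SimpleGraph.dist_eq_one_iff_adj.2 hcq
  have lc : G.dist c c = 0 := SimpleGraph.dist_self
  have hce : ¬ G.Adj c e := hl.not_adj_of_lt (by omega)
  have nce : c ≠ e := by rintro rfl; omega
  have he : IsLeg G q e f := hl.isLeg_down hqe hef (by omega)
  -- both long legs start in the neighbourhood of `q`
  have both : ¬ (G.Adj q x₁ ∧ G.Adj q x₂) := by
    rintro ⟨h1, h2⟩
    have legs : ∀ z w, IsLeg G c z w → z = q ∨ G.Adj q z := by
      intro z w hz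
      by_contra! h
      exact hG.not_common_leg hcq hs.leg₁ hs.leg₂.adj hs.ne₁₂ hs.nadj₁₂ h1 h2 hz h.1 h.2 he nce hce
    have hqy : ∀ {x y x' : V}, IsLeg G c x y → G.Adj c x' → x ≠ x' → ¬ G.Adj x x' → G.Adj q x →
        G.Adj q x' → IsLeg G q x y := by
      intro x y x' hx hx' n h hq hq'
      refine ⟨hq, hx.adj', fun h' => ?_, by rintro rfl; exact hx.nadj hcq⟩
      exact hG.not_adj_of_diamond hcq hx.adj hq hx' hq' n h h' hx.nadj hx.ne.symm hx.adj'.symm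
    have hex₁ := hG.not_adj_of_diamond hcq hs.leg₁.adj h1 hs.leg₂.adj h2 hs.ne₁₂ hs.nadj₁₂ hqe hce
      nce.symm
    have hex₂ := hG.not_adj_of_diamond hcq hs.leg₂.adj h2 hs.leg₁.adj h1 hs.ne₁₂.symm
      (fun h => hs.nadj₁₂ h.symm) hqe hce nce.symm
    have hq : IsSpider G q x₁ y₁ x₂ y₂ e :=
      ⟨hqy hs.leg₁ hs.leg₂.adj hs.ne₁₂ hs.nadj₁₂ h1 h2,
        hqy hs.leg₂ hs.leg₁.adj hs.ne₁₂.symm (fun h => hs.nadj₁₂ h.symm) h2 h1, hqe, hs.ne₁₂,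
        by rintro rfl; exact hce hs.leg₁.adj, by rintro rfl; exact hce hs.leg₂.adj, hs.nadj₁₂,
        fun h => hex₁ h.symm, fun h => hex₂ h.symm⟩
    -- now the ball of radius two around `q` contains the one around `c`, and also `f`
    have hlt : {w | G.dist c w ≤ 2}.ncard < {w | G.dist q w ≤ 2}.ncard := by
      have tri : ∀ {u v}, (u = q ∨ G.Adj q u) → G.Adj u v → G.dist q v ≤ 2 := by
        intro u v hu huv
        have h := IsPtolemaic.dist_adj_le hG.connected q huv
        rcases hu with rfl | hu
        · rw [SimpleGraph.dist_self] at h; omega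
        · rw [SimpleGraph.dist_eq_one_iff_adj.2 hu] at h; omega
      refine Set.ncard_lt_ncard ⟨?_, fun h => ?_⟩ (Set.toFinite _)
      · intro w hw
        have hw : G.dist c w ≤ 2 := hw
        have hcases : G.dist c w = 0 ∨ G.dist c w = 1 ∨ G.dist c w = 2 := by omega
        rcases hcases with h | h | h
        · rw [hG.connected.dist_eq_zero_iff] at h
          subst h
          exact tri (Or.inl rfl) hcq.symm
        · exact tri (Or.inr hcq.symm) (SimpleGraph.dist_eq_one_iff_adj.1 h)
        · obtain ⟨z, hzw, lz⟩ := hl.parent h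
          have hcz := SimpleGraph.dist_eq_one_iff_adj.1 lz
          exact tri (legs z w (hl.isLeg_down hcz hzw (by omega))) hzw
      · have : G.dist c f ≤ 2 := h (tri (Or.inr hqe) hef)
        omega
    exact absurd (hmax _ _ _ _ _ _ hq) (by omega)
  refine ⟨both, ?_, ?_⟩
  · rintro ⟨h1, h3⟩
    refine hG.not_common_leg hcq hs.leg₁ hs.adj₃ hs.ne₁₃ hs.nadj₁₃ h1 h3 hs.leg₂ ?_
      (fun h => both ⟨h1, h⟩) he nce hce
    rintro rfl
    exact hs.nadj₁₂ h1.symm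
  · rintro ⟨h2, h3⟩
    refine hG.not_common_leg hcq hs.leg₂ hs.adj₃ hs.ne₂₃ hs.nadj₂₃ h2 h3 hs.leg₁ ?_
      (fun h => both ⟨h, h2⟩) he nce hce
    rintro rfl
    exact hs.nadj₁₂ h2

/-- In the situation of `not_two_common`, a long leg and another foot of the spider avoid the
closed neighbourhood of `q`. -/
theorem exists_leg_off [Finite V] (hG : IsObstructionFree G) (hs : IsSpider G c x₁ y₁ x₂ y₂ x₃)
    (hmax : ∀ v x₁ y₁ x₂ y₂ x₃, IsSpider G v x₁ y₁ x₂ y₂ x₃ →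
      {w | G.dist v w ≤ 2}.ncard ≤ {w | G.dist c w ≤ 2}.ncard)
    {q e f : V} (hcq : G.Adj c q) (hqe : G.Adj q e) (hef : G.Adj e f) (le : G.dist c e = 2)
    (lf : G.dist c f = 3) :
    ∃ x y x', IsLeg G c x y ∧ G.Adj c x' ∧ x ≠ x' ∧ ¬ G.Adj x x' ∧ x ≠ q ∧ ¬ G.Adj x q ∧
      x' ≠ q ∧ ¬ G.Adj x' q := by
  obtain ⟨h12, h13, h23⟩ := hG.not_two_common hs hmax hcq hqe hef le lf
  have n12 : ¬ G.Adj x₂ x₁ := fun h => hs.nadj₁₂ h.symm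
  by_cases hx₁ : x₁ = q ∨ G.Adj x₁ q
  · refine ⟨x₂, y₂, x₃, hs.leg₂, hs.adj₃, hs.ne₂₃, hs.nadj₂₃, ?_⟩
    rcases hx₁ with rfl | h
    · exact ⟨hs.ne₁₂.symm, n12, hs.ne₁₃.symm, fun h => hs.nadj₁₃ h.symm⟩
    · exact ⟨by rintro rfl; exact hs.nadj₁₂ h, fun h' => h12 ⟨h.symm, h'.symm⟩,
        by rintro rfl; exact hs.nadj₁₃ h, fun h' => h13 ⟨h.symm, h'.symm⟩⟩
  · push Not at hx₁
    by_cases hx₂ : x₂ = q ∨ G.Adj x₂ q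
    · refine ⟨x₁, y₁, x₃, hs.leg₁, hs.adj₃, hs.ne₁₃, hs.nadj₁₃, hx₁.1, hx₁.2, ?_⟩
      rcases hx₂ with rfl | h
      · exact ⟨hs.ne₂₃.symm, fun h => hs.nadj₂₃ h.symm⟩
      · exact ⟨by rintro rfl; exact hs.nadj₂₃ h, fun h' => h23 ⟨h.symm, h'.symm⟩⟩
    · push Not at hx₂
      exact ⟨x₁, y₁, x₂, hs.leg₁, hs.leg₂.adj, hs.ne₁₂, hs.nadj₁₂, hx₁.1, hx₁.2, hx₂⟩

theorem even_of_vee_of_spider [Finite V] (hG : IsObstructionFree G) (hs : IsSpider G c x₁ y₁ x₂ y₂ x₃)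
    (hmax : ∀ v x₁ y₁ x₂ y₂ x₃, IsSpider G v x₁ y₁ x₂ y₂ x₃ →
      {w | G.dist v w ≤ 2}.ncard ≤ {w | G.dist c w ≤ 2}.ncard)
    {a b e f : V} (hP : IsInducedP4 G a b e f) (la : G.dist c a = G.dist c b + 1)
    (le : G.dist c e = G.dist c b + 1) (lf : G.dist c f = G.dist c b + 2) :
    Even (G.dist c b) := by
  have hl := hG.isLayering c
  by_contra hodd
  rw [Nat.even_iff] at hodd
  obtain ⟨k, hk⟩ : ∃ k, G.dist c b = 2 * k + 1 := ⟨G.dist c b / 2, by omega⟩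
  obtain ⟨q₀, hq₀, lq₀, hqq₀⟩ := hl.exists_path _ b rfl
  rw [hk] at hq₀ lq₀ hqq₀
  -- prolong the path from the root to `b` by `e` and `f`
  obtain ⟨q, hq, hqq, qb, qe, qf⟩ : ∃ q : ℕ → V, (∀ n ≤ 2 * (k + 1) + 1, G.dist c (q n) = n) ∧
      (∀ n < 2 * (k + 1) + 1, G.Adj (q n) (q (n + 1))) ∧ q (2 * k + 1) = b ∧
      q (2 * k + 2) = e ∧ q (2 * k + 3) = f := by
    refine ⟨fun n => if n ≤ 2 * k + 1 then q₀ n else if n = 2 * k + 2 then e else f,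
      fun n hn => ?_, fun n hn => ?_, by simpa using hq₀, by simp, by simp⟩
    · have hcases : n ≤ 2 * k + 1 ∨ n = 2 * k + 2 ∨ n = 2 * k + 3 := by omega
      rcases hcases with h | rfl | rfl
      · simpa [h] using lq₀ n h
      · simp; omega
      · simp; omega
    · have hcases : n < 2 * k + 1 ∨ n = 2 * k + 1 ∨ n = 2 * k + 2 := by omega
      rcases hcases with h | rfl | rfl
      · simpa [h.le, show n + 1 ≤ 2 * k + 1 by omega] using hqq₀ n h
      · simpa [hq₀] using hP.2.1.2.1
      · simpa using hP.2.1.2.2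
  have h0 : c = q 0 := hG.connected.dist_eq_zero_iff.1 (hq 0 (by omega))
  have h01 := hqq 0 (by omega)
  obtain ⟨x, y, x', hx, hx', nxx', hxx', nx, hx1, nx', hx'1⟩ := hG.exists_leg_off hs hmax
    (h0 ▸ h01) (hqq 1 (by omega)) (hqq 2 (by omega)) (hq 2 (by omega)) (hq 3 (by omega))
  have lx := SimpleGraph.dist_eq_one_iff_adj.2 hx.adj
  have ly : G.dist c y = 2 := by
    have h1 := hl.le hx.adj'
    have h2 := hG.connected.one_lt_dist_of_ne_of_not_adj hx.ne hx.nadj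
    omega
  refine hG.not_graphT (k + 1) (by omega) (graphT_isIndContained hl (by omega) hq hqq (a := a)
    (x := x) (y := y) (x' := x') ?_ (by omega) ?_ ?_ ?_ (h0 ▸ hx.adj) (h0 ▸ hx') hx.adj' lx
    (SimpleGraph.dist_eq_one_iff_adj.2 hx') ly nxx' hxx' nx nx' hx1 hx'1)
  · rw [show 2 * (k + 1) - 1 = 2 * k + 1 by omega, qb]; exact hP.2.1.1
  · rw [show 2 * (k + 1) = 2 * k + 2 by omega, qe]; exact hP.1.1
  · rw [show 2 * (k + 1) = 2 * k + 2 by omega, qe]; exact hP.2.2.1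
  · rw [show 2 * (k + 1) + 1 = 2 * k + 3 by omega, qf]; exact hP.2.2.2.1

/-- The centre of a spider with the most vertices at distance at most two is a good root. -/
theorem isGoodLayering_of_spider [Finite V] (hG : IsObstructionFree G) (hs : IsSpider G c x₁ y₁ x₂ y₂ x₃)
    (hmax : ∀ v x₁ y₁ x₂ y₂ x₃, IsSpider G v x₁ y₁ x₂ y₂ x₃ →
      {w | G.dist v w ≤ 2}.ncard ≤ {w | G.dist c w ≤ 2}.ncard) :
    IsGoodLayering G (G.dist c) 0 where
  vee := fun hP la le lf => by simpa using hG.even_of_vee_of_spider hs hmax hP la le lf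
  comparable := by
    have hl := hG.isLayering c
    intro _ _ h h'
    refine IsLayering.comparable_of ?_ h h'
    intro a b e f e' f' hab lab hae hbe le hef lf hbe' hae' le' hef' lf'
    have hle := hl.isLeg_down hae hef lf
    have hle' := hl.isLeg_down hbe' hef' (by omega)
    have hcases : G.dist c a = 0 ∨ G.dist c a = 1 ∨ G.dist c a = 2 ∨ 3 ≤ G.dist c a := by omega
    rcases hcases with h | h | h | h
    · exact hab.ne (hl.zero h (by omega))
    · have hca := SimpleGraph.dist_eq_one_iff_adj.1 h
      have hcb := SimpleGraph.dist_eq_one_iff_adj.1 (lab ▸ h)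
      obtain ⟨xa, ya, xa', ha⟩ := hG.exists_leg_off hs hmax hca hae hef (by omega) (by omega)
      obtain ⟨xb, yb, xb', hb⟩ := hG.exists_leg_off hs hmax hcb hbe' hef' (by omega) (by omega)
      have off : ∀ x y, IsLeg G c x y → x ≠ a → ¬ G.Adj x a → x ≠ b → ¬ G.Adj x b → False :=
        fun x y hx nxa hxa nxb hxb => hG.not_triangle_legs hab hca.symm hcb.symm hle hle' hx hbe
          (hl.not_adj_of_lt (by rw [SimpleGraph.dist_self]; omega)) hae'
          (hl.not_adj_of_lt (by rw [SimpleGraph.dist_self]; omega)) (fun h => hxa h.symm)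
          (fun h => hxb h.symm)
      -- one of the two legs avoids both `a` and `b`; otherwise `xa b a xb` is a path in level one
      by_cases hxab : xa = b ∨ G.Adj xa b
      · by_cases hxba : xb = a ∨ G.Adj xb a
        · obtain ⟨hxa, -, -, -, nxa, hxa', -⟩ := ha
          obtain ⟨hxb, -, -, -, nxb, hxb', -⟩ := hb
          rcases hxab with rfl | hxab
          · exact hxa' hab.symm
          rcases hxba with rfl | hxba
          · exact hxb' hab
          have nab : xa ≠ xb := by rintro rfl; exact hxb' hxab
          have hxx := hG.not_adj_ends hxab hab.symm hxba.symm hxa' (fun h => hxb' h.symm) nxa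
            nxb.symm
          exact hG.gem_free ⟨⟨nxa, nab, nxb.symm⟩, ⟨hxab, hab.symm, hxba.symm⟩, hxa', hxx,
            fun h => hxb' h.symm⟩ hxa.adj hcb hca hxb.adj
        · push Not at hxba
          exact off xb yb hb.1 hxba.1 hxba.2 hb.2.2.2.2.1 hb.2.2.2.2.2.1
      · push Not at hxab
        exact off xa ya ha.1 ha.2.2.2.2.1 ha.2.2.2.2.2.1 hxab.1 hxab.2
    · obtain ⟨p, hpa, lp⟩ := hl.parent h
      have hcp := SimpleGraph.dist_eq_one_iff_adj.1 lp
      have hpb := hl.same hab lab hpa (by omega)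
      obtain ⟨x, y, x', hx, -, -, -, nx, hxp, -⟩ := hG.exists_leg_off hs hmax hcp hpa hae h
        (by omega)
      have lc : G.dist c c = 0 := SimpleGraph.dist_self
      exact hG.not_triangle_legs hab hpa.symm hpb.symm hle hle'
        ⟨hcp.symm, hx.adj, fun h => hxp h.symm, nx.symm⟩ hbe (hl.not_adj_of_lt (by omega)) hae'
        (hl.not_adj_of_lt (by omega)) (fun h => hl.not_adj_of_lt (by omega) h.symm)
        (fun h => hl.not_adj_of_lt (by omega) h.symm)
    · exact hG.not_incomparable_of_three_le hl h hab lab hae hbe le hef lf hbe' hae' le' hef' lf'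
  not_clash := by
    intro a b x d e f hodd hab hbx hax nax la lx hxd ld hbd hbe le hae hxe hef lf
    have hl := hG.isLayering c
    rw [add_zero, Nat.even_iff] at hodd
    obtain ⟨m, hm⟩ : ∃ m, G.dist c b = m + 1 := ⟨G.dist c b - 1, by omega⟩
    obtain ⟨p, hpb, lp⟩ := hl.parent hm
    have hpa := hl.same hab.symm la.symm hpb (by omega)
    have hpx := hl.same hbx lx.symm hpb (by omega)
    have hbxd : IsLeg G b x d := ⟨hbx, hxd, hbd, by rintro rfl; omega⟩
    have hpe : ¬ G.Adj p e := hl.not_adj_of_lt (by omega)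
    have npe : p ≠ e := by rintro rfl; omega
    have fin : ∀ p' p'', IsLeg G p p' p'' → ¬ G.Adj b p' → b ≠ p' → False :=
      fun p' p'' hp' h n => hG.not_diamond_legs hpb hpa hab.symm hax nax
        (hl.isLeg_down hpx hxd (by omega)) hbxd hp' h n (hl.isLeg_down hbe hef lf) hpe npe
    rcases Nat.eq_zero_or_pos m with rfl | h
    · have : c = p := hG.connected.dist_eq_zero_iff.1 lp
      subst this
      obtain ⟨x, y, x', hx, -, -, -, nx, hxp, -⟩ := hG.exists_leg_off hs hmax hpb hbe hef
        (by omega) (by omega)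
      exact fin x y hx (fun h => hxp h.symm) nx.symm
    · obtain ⟨n, hn⟩ : ∃ n, m = n + 2 := ⟨m - 2, by omega⟩
      obtain ⟨p', hp', lp'⟩ := hl.parent (v := p) (n := n + 1) (by omega)
      obtain ⟨p'', hp'', lp''⟩ := hl.parent lp'
      exact fin p' p'' (hl.isLeg_up hp'.symm hp''.symm (by omega))
        (fun h => hl.not_adj_of_lt (by omega) h.symm) (by rintro rfl; omega)

end Spider

/-- In a layering with at most `D` levels, an induced `P₆` cannot have its middle edge among the
three deepest levels: it would yield `G₁` or a spider. -/
theorem not_deep_path (hG : IsObstructionFree G)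
    (hns : ∀ v x₁ y₁ x₂ y₂ x₃, ¬ IsSpider G v x₁ y₁ x₂ y₂ x₃) {m : V → ℕ} (hm : IsLayering G m)
    {D : ℕ} (hD : 5 ≤ D) (hmD : ∀ v, m v ≤ D) {a b e f e' f' : V} (hab : G.Adj a b)
    (hae : IsLeg G a e f) (hbe : ¬ G.Adj b e) (nbe : b ≠ e) (hbe' : IsLeg G b e' f')
    (hae' : ¬ G.Adj a e') (nae' : a ≠ e') (ma : D ≤ m a + 2) (mb : D ≤ m b + 2) : False := by
  -- an ascending middle edge leads below the deepest level
  have asc : ∀ {a b e' f' : V}, G.Adj a b → IsLeg G b e' f' → ¬ G.Adj a e' → a ≠ e' →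
      D ≤ m a + 2 → m b ≠ m a + 1 := by
    intro a b e' f' hab hbe' hae' nae' ma h
    have h1 := hm.ascend hab hbe'.adj hae' nae' h
    have h2 := hm.ascend hbe'.adj hbe'.adj' hbe'.nadj hbe'.ne h1
    have := hmD f'
    omega
  have hmab : m a = m b := by
    have h1 := hm.le hab
    have h2 := hm.le hab.symm
    have h3 := asc hab hbe' hae' nae' ma
    have h4 := asc hab.symm hae hbe nbe mb
    omega
  -- a horizontal middle edge whose side at `b` ascends
  have flat : ∀ {a b e f e' f' : V}, G.Adj a b → IsLeg G a e f → ¬ G.Adj b e → b ≠ e →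
      IsLeg G b e' f' → ¬ G.Adj a e' → a ≠ e' → D ≤ m a + 2 → m a = m b → m e' ≠ m b + 1 := by
    intro a b e f e' f' hab hae hbe nbe hbe' hae' nae' ma hmab h
    have hf' := hm.ascend hbe'.adj hbe'.adj' hbe'.nadj hbe'.ne h
    have hD' := hmD f'
    obtain ⟨n, hn⟩ : ∃ n, m a = n + 3 := ⟨m a - 3, by omega⟩
    obtain ⟨u, hua, mu⟩ := hm.parent (v := a) (n := n + 2) (by omega)
    obtain ⟨u', hu', mu'⟩ := hm.parent mu
    obtain ⟨u'', hu'', mu''⟩ := hm.parent mu'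
    have hub := hm.same hab hmab hua (by omega)
    have he := hm.le_of_flat hab.symm hae.adj hbe hmab.symm
    have he1 := hm.le hae.adj
    rcases Nat.lt_or_ge (m a) (m e) with h' | h'
    · exact hG.not_triangle_legs hab hua.symm hub.symm hae hbe'
        (hm.isLeg_up hu'.symm hu''.symm (by omega)) hbe (hm.not_adj_of_lt (by omega)) hae'
        (hm.not_adj_of_lt (by omega)) (fun h => hm.not_adj_of_lt (by omega) h.symm)
        (fun h => hm.not_adj_of_lt (by omega) h.symm)
    · have hef := hm.le_of_flat hae.adj hae.adj' hae.nadj (by omega)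
      have hef1 := hm.le hae.adj'
      have hbf : ¬ G.Adj b f := hG.not_adj_ends hab.symm hae.adj hae.adj' hbe hae.nadj nbe hae.ne
      have nbf : b ≠ f := by rintro rfl; exact hae.nadj hab
      have hne : m e ≠ m f := hm.not_flat
        ⟨⟨nbe, nbf, hae.ne⟩, ⟨hab.symm, hae.adj, hae.adj'⟩, hbe, hbf, hae.nadj⟩ hmab.symm
        (by omega)
      have hue := hm.same hae.adj (by omega) hua (by omega)
      exact hns u b e' e f u'
        ⟨⟨hub, hbe'.adj, hm.not_adj_of_lt (by omega), by rintro rfl; omega⟩,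
        ⟨hue, hae.adj', hm.not_adj_of_lt (by omega), by rintro rfl; omega⟩, hu'.symm, nbe,
        by rintro rfl; omega, by rintro rfl; omega, hbe,
        fun h => hm.not_adj_of_lt (by omega) h.symm, fun h => hm.not_adj_of_lt (by omega) h.symm⟩
  have h1 := hm.le_of_flat hab hbe'.adj hae' hmab
  have h2 := hm.le hbe'.adj
  have h3 := hm.le_of_flat hab.symm hae.adj hbe hmab.symm
  have h4 := hm.le hae.adj
  have h5 := flat hab hae hbe nbe hbe' hae' nae' ma hmab
  have h6 := flat hab.symm hbe' hae' nae' hae hbe nbe mb hmab.symm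
  exact hm.not_flat (a := e) (b := a) (c := b) (d := e')
    ⟨⟨nbe.symm, by rintro rfl; exact hae' hae.adj, nae'⟩, ⟨hae.adj.symm, hab, hbe'.adj⟩,
      fun h => hbe h.symm,
      hG.not_adj_ends hae.adj.symm hab hbe'.adj (fun h => hbe h.symm) hae' nbe.symm nae', hae'⟩
    (by omega) hmab (by omega)

/-- The ends of an induced `P₆` have distance five. -/
theorem dist_ends (hG : IsObstructionFree G) {a b e f e' f' : V} (hab : G.Adj a b)
    (hae : IsLeg G a e f) (hbe : ¬ G.Adj b e) (nbe : b ≠ e) (hbe' : IsLeg G b e' f')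
    (hae' : ¬ G.Adj a e') (nae' : a ≠ e') : G.dist f f' = 5 := by
  have hm := hG.isLayering f
  have h0 : G.dist f f = 0 := SimpleGraph.dist_self
  have h1 : G.dist f e = 1 := SimpleGraph.dist_eq_one_iff_adj.2 hae.adj'.symm
  have h2 := hm.ascend hae.adj'.symm hae.adj.symm (fun h => hae.nadj h.symm) hae.ne.symm (by omega)
  have h3 := hm.ascend hae.adj.symm hab (fun h => hbe h.symm) nbe.symm h2
  have h4 := hm.ascend hab hbe'.adj hae' nae' h3
  have h5 := hm.ascend hbe'.adj hbe'.adj' hbe'.nadj hbe'.ne h4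
  omega

/-- Without spiders, an end of a longest shortest path is a good root; the levels are shifted by
one. -/
theorem isGoodLayering_of_not_spider (hG : IsObstructionFree G)
    (hns : ∀ v x₁ y₁ x₂ y₂ x₃, ¬ IsSpider G v x₁ y₁ x₂ y₂ x₃) {c t : V}
    (hmax : ∀ u v, G.dist u v ≤ G.dist t c) : IsGoodLayering G (G.dist c) 1 where
  vee := by
    intro a b e f hP la le lf
    have hl := hG.isLayering c
    obtain ⟨⟨n1, n2, n3⟩, ⟨h1, h2, h3⟩, h4, h5, h6⟩ := hP
    by_contra hodd
    rw [Nat.even_iff] at hodd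
    rcases Nat.eq_zero_or_pos (G.dist c b) with h | h
    · -- at the root, the path cannot be placed in the layering from `t`
      have : c = b := hG.connected.dist_eq_zero_iff.1 h
      subst this
      have hm := hG.isLayering t
      have ma := hmax t a
      have me := hmax t e
      have mf := hmax t f
      have hlt : G.dist t c ≠ G.dist t a + 1 := fun h' => by
        have := hm.ascend h1 h2 h4 n1 h'
        omega
      have h1' := hm.le h1
      have he := hm.le_of_flat h1 h2 h4 (by omega)
      have hf := hm.le_of_flat h2 h3 h6 (by omega)
      exact hm.not_flat ⟨⟨n1, n2, n3⟩, ⟨h1, h2, h3⟩, h4, h5, h6⟩ (by omega) (by omega) (by omega)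
    · obtain ⟨n, hn⟩ : ∃ n, G.dist c b = n + 2 := ⟨G.dist c b - 2, by omega⟩
      obtain ⟨p, hp, lp⟩ := hl.parent (v := b) (n := n + 1) (by omega)
      obtain ⟨p', hp', lp'⟩ := hl.parent lp
      exact hns b e f p p' a ⟨⟨h2, h3, h6, n3⟩, hl.isLeg_up hp.symm hp'.symm (by omega), h1.symm,
        by rintro rfl; omega, n1.symm, by rintro rfl; omega,
        fun h => hl.not_adj_of_lt (by omega) h.symm, fun h => h4 h.symm,
        hl.not_adj_of_lt (by omega)⟩
  comparable := by
    have hl := hG.isLayering c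
    have hm := hG.isLayering t
    intro _ _ h h'
    refine IsLayering.comparable_of ?_ h h'
    intro a b e f e' f' hab lab hae hbe le hef lf hbe' hae' le' hef' lf'
    have hle := hl.isLeg_down hae hef lf
    have hle' := hl.isLeg_down hbe' hef' (by omega)
    have nbe : b ≠ e := by rintro rfl; omega
    have nae' : a ≠ e' := by rintro rfl; omega
    have h5 : 5 ≤ G.dist t c := (hG.dist_ends hab hle hbe nbe hle' hae' nae').ge.trans (hmax _ _)
    have near : G.dist t c ≤ G.dist t a + 2 → G.dist t c ≤ G.dist t b + 2 → False :=
      hG.not_deep_path hns hm h5 (hmax t) hab hle hbe nbe hle' hae' nae'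
    have hcases : G.dist c a = 0 ∨ G.dist c a = 1 ∨ G.dist c a = 2 ∨ 3 ≤ G.dist c a := by omega
    rcases hcases with h | h | h | h
    · exact hab.ne (hl.zero h (by omega))
    · have h1 := hm.le (SimpleGraph.dist_eq_one_iff_adj.1 h).symm
      have h2 := hm.le (SimpleGraph.dist_eq_one_iff_adj.1 (lab ▸ h)).symm
      exact near (by omega) (by omega)
    · obtain ⟨p, hpa, lp⟩ := hl.parent h
      have h1 := hm.le (SimpleGraph.dist_eq_one_iff_adj.1 lp).symm
      have h2 := hm.le hpa.symm
      have h3 := hm.le (hl.same hab lab hpa (by omega)).symm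
      exact near (by omega) (by omega)
    · exact hG.not_incomparable_of_three_le hl h hab lab hae hbe le hef lf hbe' hae' le' hef' lf'
  not_clash := by
    intro a b x d e f _ hab hbx hax nax la lx hxd ld hbd hbe le hae hxe hef lf
    have hl := hG.isLayering c
    exact hns b e f x d a ⟨hl.isLeg_down hbe hef lf, ⟨hbx, hxd, hbd, by rintro rfl; omega⟩,
      hab.symm, by rintro rfl; omega, by rintro rfl; omega, nax.symm, fun h => hxe h.symm,
      fun h => hae h.symm, fun h => hax h.symm⟩

theorem hasOppositionRanking [Finite V] (hG : IsObstructionFree G) : HasOppositionRanking G := by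
  classical
  have := hG.connected.nonempty
  by_cases hs : ∃ v x₁ y₁ x₂ y₂ x₃, IsSpider G v x₁ y₁ x₂ y₂ x₃
  · obtain ⟨v₀, hv₀⟩ := hs
    obtain ⟨c, ⟨x₁, y₁, x₂, y₂, x₃, hc⟩, hmax⟩ := Set.exists_max_image
      {v | ∃ x₁ y₁ x₂ y₂ x₃, IsSpider G v x₁ y₁ x₂ y₂ x₃} (fun v => {w | G.dist v w ≤ 2}.ncard)
      (Set.toFinite _) ⟨v₀, hv₀⟩
    exact ((hG.isGoodLayering_of_spider hc fun v x₁ y₁ x₂ y₂ x₃ h =>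
      hmax v ⟨x₁, y₁, x₂, y₂, x₃, h⟩).isOppositionRanking hG.toIsPtolemaic
      (hG.isLayering c)).hasOppositionRanking
  · push Not at hs
    obtain ⟨⟨t, c⟩, hmax⟩ := Finite.exists_max (fun p : V × V => G.dist p.1 p.2)
    exact ((hG.isGoodLayering_of_not_spider hs (c := c) (t := t)
      fun u v => hmax (u, v)).isOppositionRanking hG.toIsPtolemaic
      (hG.isLayering c)).hasOppositionRanking

end IsObstructionFree

/-! ### Reduction along modules -/

/-- Every vertex outside `M` is adjacent to all vertices of `M` or to none. -/
def IsModule {V : Type*} (G : SimpleGraph V) (M : Set V) : Prop :=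
  ∀ v ∉ M, ∀ x ∈ M, ∀ y ∈ M, G.Adj v x → G.Adj v y

/-- An opposition ranking can be assembled from one of the module and one of the graph in which the
module is replaced by a single vertex `m`, because an induced `P₄` with two vertices in a module is
contained in it. -/
theorem HasOppositionRanking.of_module {V : Type*} [Finite V] {G : SimpleGraph V} {M : Set V}
    (hM : IsModule G M) {m : V} (hm : m ∈ M) (h1 : HasOppositionRanking (G.induce M))
    (h2 : HasOppositionRanking (G.induce {v | v ∉ M ∨ v = m})) : HasOppositionRanking G := by
  classical
  obtain ⟨f, hf⟩ := h1
  obtain ⟨g, hg⟩ := h2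
  set π : V → V := fun v => if v ∈ M then m else v with hπ
  have πM : ∀ {v}, v ∈ M → π v = m := fun h => if_pos h
  have πN : ∀ {v}, v ∉ M → π v = v := fun h => if_neg h
  have hπmem : ∀ v, π v ∈ {v | v ∉ M ∨ v = m} := by
    intro v
    by_cases h : v ∈ M
    · exact Or.inr (πM h)
    · rw [πN h]; exact Or.inl h
  set f' : V → ℕ := fun v => if h : v ∈ M then f ⟨v, h⟩ else 0 with hf'
  have f'M : ∀ {v} (h : v ∈ M), f' v = f ⟨v, h⟩ := fun h => dif_pos h
  set r : V → ℕ ×ₗ ℕ := fun v => toLex (g ⟨π v, hπmem v⟩, f' v) with hr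
  have hr1 : ∀ {u v}, g ⟨π u, hπmem u⟩ < g ⟨π v, hπmem v⟩ → r u < r v :=
    fun h => Prod.Lex.toLex_lt_toLex.2 (Or.inl h)
  have hr2 : ∀ {u v} (hu : u ∈ M) (hv : v ∈ M), f ⟨u, hu⟩ < f ⟨v, hv⟩ → r u < r v := by
    intro u v hu hv h
    refine Prod.Lex.toLex_lt_toLex.2 (Or.inr ⟨?_, by rwa [f'M hu, f'M hv]⟩)
    exact congrArg g (Subtype.ext ((πM hu).trans (πM hv).symm))
  -- the contraction `π` does not change how two vertices are related unless both lie in `M`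
  have hadj : ∀ {u v}, ¬ (u ∈ M ∧ v ∈ M) → (G.Adj (π u) (π v) ↔ G.Adj u v) := by
    intro u v h
    by_cases hu : u ∈ M
    · have hv : v ∉ M := fun hv => h ⟨hu, hv⟩
      rw [πM hu, πN hv, G.adj_comm, G.adj_comm u]
      exact ⟨hM v hv m hm u hu, hM v hv u hu m hm⟩
    · by_cases hv : v ∈ M
      · rw [πN hu, πM hv]
        exact ⟨hM u hu m hm v hv, hM u hu v hv m hm⟩
      · rw [πN hu, πN hv]
  have hne : ∀ {u v}, ¬ (u ∈ M ∧ v ∈ M) → u ≠ v → π u ≠ π v := by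
    intro u v h huv
    by_cases hu : u ∈ M
    · have hv : v ∉ M := fun hv => h ⟨hu, hv⟩
      rw [πM hu, πN hv]
      rintro rfl
      exact hv hm
    · by_cases hv : v ∈ M
      · rw [πN hu, πM hv]
        rintro rfl
        exact hu hm
      · rwa [πN hu, πN hv]
  refine IsOppositionRanking.hasOppositionRanking (f := r) fun a b c d hP => ?_
  have hP' := hP
  obtain ⟨⟨n1, n2, n3⟩, ⟨e1, e2, e3⟩, e4, e5, e6⟩ := hP'
  have sep : ∀ {u v w}, u ∈ M → v ∈ M → G.Adj w u → ¬ G.Adj w v → w ∈ M := by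
    intro u v w hu hv hwu hwv
    by_contra hw
    exact hwv (hM w hw u hu v hv hwu)
  have s1 : a ∈ M → b ∈ M → c ∈ M := fun h h' => sep h' h e2.symm fun h => e4 h.symm
  have s2 : a ∈ M → c ∈ M → d ∈ M := fun h h' => sep h' h e3.symm fun h => e5 h.symm
  have s3 : b ∈ M → c ∈ M → a ∈ M := fun h h' => sep h h' e1 e4
  have s4 : c ∈ M → d ∈ M → b ∈ M := fun h h' => sep h h' e2 e6
  have s5 : b ∈ M → d ∈ M → a ∈ M := fun h h' => sep h h' e1 e5
  have s6 : a ∈ M → d ∈ M → b ∈ M := fun h h' => sep h h' e1.symm e6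
  by_cases hall : a ∈ M ∧ b ∈ M ∧ c ∈ M ∧ d ∈ M
  · obtain ⟨ha, hb, hc, hd⟩ := hall
    rcases hf ⟨a, ha⟩ ⟨b, hb⟩ ⟨c, hc⟩ ⟨d, hd⟩
      ⟨⟨by simpa using n1, by simpa using n2, by simpa using n3⟩, ⟨e1, e2, e3⟩, e4, e5, e6⟩
      with h | h
    · exact Or.inl ⟨hr2 _ _ h.1, hr2 _ _ h.2⟩
    · exact Or.inr ⟨hr2 _ _ h.1, hr2 _ _ h.2⟩
  · have i1 : ¬ (a ∈ M ∧ b ∈ M) :=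
      fun ⟨ha, hb⟩ => hall ⟨ha, hb, s1 ha hb, s2 ha (s1 ha hb)⟩
    have i2 : ¬ (b ∈ M ∧ c ∈ M) :=
      fun ⟨hb, hc⟩ => hall ⟨s3 hb hc, hb, hc, s2 (s3 hb hc) hc⟩
    have i3 : ¬ (c ∈ M ∧ d ∈ M) :=
      fun ⟨hc, hd⟩ => hall ⟨s3 (s4 hc hd) hc, s4 hc hd, hc, hd⟩
    have i4 : ¬ (a ∈ M ∧ c ∈ M) :=
      fun ⟨ha, hc⟩ => hall ⟨ha, s4 hc (s2 ha hc), hc, s2 ha hc⟩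
    have i5 : ¬ (a ∈ M ∧ d ∈ M) :=
      fun ⟨ha, hd⟩ => hall ⟨ha, s6 ha hd, s1 ha (s6 ha hd), hd⟩
    have i6 : ¬ (b ∈ M ∧ d ∈ M) :=
      fun ⟨hb, hd⟩ => hall ⟨s5 hb hd, hb, s1 (s5 hb hd) hb, hd⟩
    rcases hg ⟨π a, hπmem a⟩ ⟨π b, hπmem b⟩ ⟨π c, hπmem c⟩ ⟨π d, hπmem d⟩
      ⟨⟨fun h => hne i4 n1 (congrArg Subtype.val h), fun h => hne i5 n2 (congrArg Subtype.val h),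
        fun h => hne i6 n3 (congrArg Subtype.val h)⟩,
        ⟨(hadj i1).2 e1, (hadj i2).2 e2, (hadj i3).2 e3⟩,
        fun h => e4 ((hadj i4).1 h), fun h => e5 ((hadj i5).1 h), fun h => e6 ((hadj i6).1 h)⟩
      with h | h
    · exact Or.inl ⟨hr1 h.1, hr1 h.2⟩
    · exact Or.inr ⟨hr1 h.1, hr1 h.2⟩

/-- The vertices that can be reached from `x` through nonadjacent vertices with the property `P`. -/
def coComponent {V : Type*} (G : SimpleGraph V) (P : V → Prop) (x : V) : Set V :=
  {v | Relation.ReflTransGen (fun u v => ¬ G.Adj u v ∧ P v) x v}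

section coComponent

variable {V : Type*} {G : SimpleGraph V} {P : V → Prop} {x : V}

theorem coComponent_self : x ∈ coComponent G P x := Relation.ReflTransGen.refl

theorem mem_coComponent {u v : V} (hu : u ∈ coComponent G P x) (huv : ¬ G.Adj u v) (hv : P v) :
    v ∈ coComponent G P x := Relation.ReflTransGen.tail hu ⟨huv, hv⟩

theorem coComponent_prop (hx : P x) {v : V} (hv : v ∈ coComponent G P x) : P v := by
  induction hv with
  | refl => exact hx
  | tail _ h _ => exact h.2

/-- A property that nonadjacent members of a co-component share is shared by all its members. -/
theorem coComponent_const {Q : V → Prop}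
    (h : ∀ u ∈ coComponent G P x, ∀ v ∈ coComponent G P x, ¬ G.Adj u v → (Q u → Q v)) {v : V}
    (hv : v ∈ coComponent G P x) : Q v ↔ Q x := by
  induction hv with
  | refl => rfl
  | tail hu h' ih =>
    have hv := mem_coComponent hu h'.1 h'.2
    exact ⟨fun h'' => ih.1 (h _ hv _ hu (fun h => h'.1 h.symm) h''),
      fun h'' => h _ hu _ hv h'.1 (ih.2 h'')⟩

/-- If a co-component is not a module, an outside vertex distinguishes two nonadjacent members. -/
theorem exists_distinguished (h : ¬ IsModule G (coComponent G P x)) :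
    ∃ u ∉ coComponent G P x, ∃ p ∈ coComponent G P x, ∃ p' ∈ coComponent G P x,
      ¬ G.Adj p p' ∧ G.Adj u p ∧ ¬ G.Adj u p' := by
  by_contra! hn
  refine h fun u hu p hp p' hp' hup => ?_
  have const : ∀ v ∈ coComponent G P x, (G.Adj u v ↔ G.Adj u x) := fun _ => coComponent_const
    (Q := fun v => G.Adj u v) (fun p hp p' hp' hpp' => hn u hu p hp p' hp' hpp')
  exact (const p' hp').2 ((const p hp).1 hup)

end coComponent

/-- In a distance-hereditary graph without `A`, a `C₄` yields a nontrivial module: take the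
co-component `X` of `x₁` in the common neighbourhood of `y₁`, `y₂` and the co-component `Y` of `y₁`
in the common neighbourhood of `X`. If neither is a module, a vertex distinguishing members of
`X` and one distinguishing members of `Y` produce a house, a domino or an `A`. -/
theorem exists_module_of_square {V : Type*} {G : SimpleGraph V} (hG : IsDistanceHereditary G)
    (hA : ¬ graphA.IsIndContained G) {x₁ x₂ y₁ y₂ : V} (h11 : G.Adj x₁ y₁) (h12 : G.Adj x₁ y₂)
    (h21 : G.Adj x₂ y₁) (h22 : G.Adj x₂ y₂) (hx : ¬ G.Adj x₁ x₂) (nx : x₁ ≠ x₂)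
    (hy : ¬ G.Adj y₁ y₂) (ny : y₁ ≠ y₂) :
    ∃ M : Set V, IsModule G M ∧ (∃ u ∈ M, ∃ v ∈ M, u ≠ v) ∧ ∃ w, w ∉ M := by
  obtain ⟨-, hhouse, hdomino, -⟩ := hG
  set X := coComponent G (fun v => G.Adj v y₁ ∧ G.Adj v y₂) x₁
  set Y := coComponent G (fun v => ∀ x ∈ X, G.Adj x v) y₁
  have hXprop : ∀ v ∈ X, G.Adj v y₁ ∧ G.Adj v y₂ := fun v hv =>
    coComponent_prop (P := fun v => G.Adj v y₁ ∧ G.Adj v y₂) ⟨h11, h12⟩ hv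
  have hXY : ∀ y ∈ Y, ∀ x ∈ X, G.Adj x y :=
    fun y hy => coComponent_prop (P := fun v => ∀ x ∈ X, G.Adj x v) (fun x hx => (hXprop x hx).1) hy
  have hx₁ : x₁ ∈ X := coComponent_self
  have hx₂ : x₂ ∈ X := mem_coComponent hx₁ hx ⟨h21, h22⟩
  have hy₁ : y₁ ∈ Y := coComponent_self
  have hy₂ : y₂ ∈ Y := mem_coComponent hy₁ hy fun x hx => (hXprop x hx).2
  by_cases hMX : IsModule G X
  · exact ⟨X, hMX, ⟨x₁, hx₁, x₂, hx₂, nx⟩, y₁, fun h => G.irrefl (hXprop _ h).1⟩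
  by_cases hMY : IsModule G Y
  · exact ⟨Y, hMY, ⟨y₁, hy₁, y₂, hy₂, ny⟩, x₁, fun h => G.irrefl (hXY _ h _ hx₁)⟩
  exfalso
  obtain ⟨u, hu, p, hp, p', hp', hpp', hup, hup'⟩ := exists_distinguished hMX
  obtain ⟨w, hw, r, hr, r', hr', hrr', hwr, hwr'⟩ := exists_distinguished hMY
  have huY : ∀ y ∈ Y, ¬ G.Adj u y := by
    have hconst : ∀ y ∈ Y, (G.Adj u y ↔ G.Adj u y₁) := fun y hy =>
      coComponent_const (Q := fun v => G.Adj u v) (fun y hy y' hy' hyy' huy => by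
        by_contra huy'
        exact hhouse (house_isIndContained u p y p' y' (hXY y hy p hp) (hXY y' hy' p hp)
          (hXY y hy p' hp') (hXY y' hy' p' hp') hpp' hyy' hup huy hup' huy')) hy
    intro y hy huy
    have h1 := (hconst y hy).1 huy
    exact hu (mem_coComponent hp' (fun h => hup' h.symm) ⟨h1, (hconst _ hy₂).2 h1⟩)
  have hwX : ∀ x ∈ X, ¬ G.Adj w x := by
    have hconst : ∀ x ∈ X, (G.Adj w x ↔ G.Adj w x₁) := fun x hx =>
      coComponent_const (Q := fun v => G.Adj w v) (fun x hx x' hx' hxx' hwx => by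
        by_contra hwx'
        exact hhouse (house_isIndContained w r x r' x' (hXY r hr x hx).symm (hXY r hr x' hx').symm
          (hXY r' hr' x hx).symm (hXY r' hr' x' hx').symm hrr' hxx' hwr hwx hwr' hwx')) hx
    intro x hx hwx
    have h1 := (hconst x hx).1 hwx
    exact hw (mem_coComponent hr' (fun h => hwr' h.symm)
      fun x' hx' => ((hconst x' hx').2 h1).symm)
  have hpr := hXY r hr p hp
  have hpr' := hXY r' hr' p hp
  have hp'r := hXY r hr p' hp'
  have hp'r' := hXY r' hr' p' hp'
  have hur := huY r hr
  have hur' := huY r' hr'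
  have hwp : ¬ G.Adj p w := fun h => hwX p hp h.symm
  have hwp' := hwX p' hp'
  by_cases huw : G.Adj u w
  · exact hdomino (domino_isIndContained p u w r p' r' hup.symm hwp hpr hpp' hpr' huw hur hup' hur'
      hwr hwp' hwr' hp'r.symm hrr' hp'r')
  · exact hA (graphA_isIndContained u p r w r' p' hup hur huw hur' hup' hpr hwp hpr' hpp' hwr.symm
      hrr' hp'r.symm hwr' hwp' hp'r'.symm)

/-! ### Existence of the ranking -/

/-- The excluded induced subgraphs: those of distance-hereditary graphs and the families of the
fourth condition. -/
structure IsExcluding {V : Type*} (G : SimpleGraph V) : Prop where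
  isDistanceHereditary : IsDistanceHereditary G
  not_graphT : ∀ k, 1 ≤ k → ¬ (graphT k).IsIndContained G
  not_graphA : ¬ graphA.IsIndContained G
  not_graphG1 : ¬ graphG1.IsIndContained G
  not_graphG2 : ¬ graphG2.IsIndContained G

theorem IsExcluding.mono {V W : Type*} {G : SimpleGraph V} {H : SimpleGraph W}
    (hG : IsExcluding G) (h : H.IsIndContained G) : IsExcluding H where
  isDistanceHereditary :=
    ⟨fun h' => hG.1.1 (h'.trans h), fun h' => hG.1.2.1 (h'.trans h),
      fun h' => hG.1.2.2.1 (h'.trans h), fun n hn h' => hG.1.2.2.2 n hn (h'.trans h)⟩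
  not_graphT := fun k hk h' => hG.2 k hk (h'.trans h)
  not_graphA := fun h' => hG.3 (h'.trans h)
  not_graphG1 := fun h' => hG.4 (h'.trans h)
  not_graphG2 := fun h' => hG.5 (h'.trans h)

/-- A connected graph without the excluded subgraphs has a nontrivial module unless it is chordal
and gem-free. -/
theorem IsExcluding.module_or_isObstructionFree {V : Type*} {G : SimpleGraph V}
    (hG : IsExcluding G) (hc : G.Connected) :
    (∃ M : Set V, IsModule G M ∧ (∃ u ∈ M, ∃ v ∈ M, u ≠ v) ∧ ∃ w, w ∉ M) ∨
      IsObstructionFree G := by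
  by_cases h4 : (SimpleGraph.cycleGraph 4).IsIndContained G
  · left
    obtain ⟨φ⟩ := h4
    have hadj : ∀ i j, G.Adj (φ i) (φ j) ↔ (SimpleGraph.cycleGraph 4).Adj i j :=
      fun i j => φ.map_adj_iff
    simp only [SimpleGraph.cycleGraph_adj] at hadj
    refine exists_module_of_square hG.isDistanceHereditary hG.not_graphA (x₁ := φ 0) (x₂ := φ 2)
      (y₁ := φ 1) (y₂ := φ 3) ?_ ?_ ?_ ?_ ?_ (φ.injective.ne (by decide)) ?_
      (φ.injective.ne (by decide)) <;> rw [hadj] <;> decide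
  · right
    obtain ⟨hd1, -, -, hd4⟩ := hG.isDistanceHereditary
    exact
      { not_gem := hd1
        not_hole := fun n hn => by
          rcases hn.eq_or_lt with rfl | h
          · exact h4
          · exact hd4 n h
        connected := hc
        not_graphT := hG.not_graphT
        not_graphG1 := hG.not_graphG1
        not_graphG2 := hG.not_graphG2 }

theorem IsExcluding.hasOppositionRanking (n : ℕ) : ∀ {V : Type*} [Finite V] {G : SimpleGraph V},
    Nat.card V = n → IsExcluding G → HasOppositionRanking G := by
  induction n using Nat.strong_induction_on with
  | _ n ih =>
  intro V _ G hn hG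
  have sub : ∀ S : Set V, (∃ v, v ∉ S) → HasOppositionRanking (G.induce S) := by
    rintro S ⟨v, hv⟩
    have hlt : Nat.card S < n := by
      rw [← hn, Nat.card_coe_set_eq, ← Set.ncard_univ]
      exact Set.ncard_lt_ncard ⟨Set.subset_univ _, fun h => hv (h (Set.mem_univ v))⟩
        (Set.toFinite _)
    exact ih _ hlt rfl (hG.mono ⟨SimpleGraph.Embedding.induce S⟩)
  have byModule : (∃ M : Set V, IsModule G M ∧ (∃ u ∈ M, ∃ v ∈ M, u ≠ v) ∧ ∃ w, w ∉ M) →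
      HasOppositionRanking G := by
    rintro ⟨M, hM, ⟨u, hu, v, hv, huv⟩, hw⟩
    refine .of_module hM hu (sub M hw) (sub _ ⟨v, ?_⟩)
    rintro (h | h)
    · exact h hv
    · exact huv h.symm
  by_cases hedge : ∃ a b, G.Adj a b
  · obtain ⟨a, b, hab⟩ := hedge
    by_cases hc : G.Connected
    · rcases hG.module_or_isObstructionFree hc with h | h
      · exact byModule h
      · exact h.hasOppositionRanking
    · -- the component of an edge is a nontrivial module
      refine byModule ⟨{v | G.Reachable a v}, fun v hv x hx y _ hvx => ?_,
        ⟨a, SimpleGraph.Reachable.refl a, b, hab.reachable, hab.ne⟩, ?_⟩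
      · exact absurd (SimpleGraph.Reachable.trans hx hvx.symm.reachable) hv
      · by_contra! h
        have : Nonempty V := ⟨a⟩
        exact hc ⟨fun u v => (h u).symm.trans (h v)⟩
  · push Not at hedge
    exact ⟨fun _ => 0, fun a b c d h => absurd h.2.1.1 (hedge a b)⟩

/-! ### Obstructions to generalized opposition graphs -/

theorem IsInducedP4.map {V W : Type*} {G : SimpleGraph V} {H : SimpleGraph W} (φ : H ↪g G)
    {a b c d : W} (h : IsInducedP4 H a b c d) : IsInducedP4 G (φ a) (φ b) (φ c) (φ d) := by
  obtain ⟨⟨n1, n2, n3⟩, ⟨h1, h2, h3⟩, h4, h5, h6⟩ := h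
  exact ⟨⟨φ.injective.ne n1, φ.injective.ne n2, φ.injective.ne n3⟩,
    ⟨φ.map_adj_iff.2 h1, φ.map_adj_iff.2 h2, φ.map_adj_iff.2 h3⟩,
    fun h => h4 (φ.map_adj_iff.1 h), fun h => h5 (φ.map_adj_iff.1 h),
    fun h => h6 (φ.map_adj_iff.1 h)⟩

theorem isGeneralizedOppositionGraph_mono {V W : Type*} {G : SimpleGraph V} {H : SimpleGraph W}
    (h : H.IsIndContained G) (hG : IsGeneralizedOppositionGraph G) :
    IsGeneralizedOppositionGraph H := by
  obtain ⟨φ⟩ := h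
  obtain ⟨D, ⟨hD1, hD2⟩, hD3⟩ := hG
  exact ⟨fun x y => D (φ x) (φ y), ⟨fun x y h => φ.map_adj_iff.1 (hD1 _ _ h),
    fun x y h => hD2 _ _ (φ.map_adj_iff.2 h)⟩, fun a b c d h => hD3 _ _ _ _ (IsInducedP4.map φ h)⟩

/-- In an orientation in opposition, the end-edges of an induced `P₄` determine each other. -/
theorem opposition_iff {V : Type*} {G : SimpleGraph V} {D : V → V → Prop}
    (hD : IsOrientation G D) (hO : OrientsInOpposition G D) {a b c d : V}
    (h : IsInducedP4 G a b c d) : D a b ↔ D d c := by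
  have h1 := hD.2 a b h.2.1.1
  have h2 := hD.2 c d h.2.1.2.2
  have h3 := hO a b c d h
  simp only [Xor] at h1 h2
  tauto

theorem orientation_not {V : Type*} {G : SimpleGraph V} {D : V → V → Prop}
    (hD : IsOrientation G D) {a b : V} (h : G.Adj a b) : D a b ↔ ¬ D b a := by
  have h1 := hD.2 a b h
  simp only [Xor] at h1
  tauto

theorem graphA_not_isGeneralizedOppositionGraph : ¬ IsGeneralizedOppositionGraph graphA := by
  rintro ⟨D, hD, hO⟩
  have p1 : IsInducedP4 graphA 0 1 2 3 := by
    simp [IsInducedP4, graphA, Fin.ext_iff]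
  have p2 : IsInducedP4 graphA 0 1 4 5 := by
    simp [IsInducedP4, graphA, Fin.ext_iff]
  have p3 : IsInducedP4 graphA 3 2 5 4 := by
    simp [IsInducedP4, graphA, Fin.ext_iff]
  have h1 := opposition_iff hD hO p1
  have h2 := opposition_iff hD hO p2
  have h3 := opposition_iff hD hO p3
  have h4 := orientation_not hD p2.2.1.2.2
  tauto

theorem graphG1_not_isGeneralizedOppositionGraph : ¬ IsGeneralizedOppositionGraph graphG1 := by
  rintro ⟨D, hD, hO⟩
  have p1 : IsInducedP4 graphG1 0 1 2 3 := by
    simp [IsInducedP4, graphG1, Fin.ext_iff]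
  have p2 : IsInducedP4 graphG1 0 1 2 6 := by
    simp [IsInducedP4, graphG1, Fin.ext_iff]
  have p3 : IsInducedP4 graphG1 5 4 3 2 := by
    simp [IsInducedP4, graphG1, Fin.ext_iff]
  have p4 : IsInducedP4 graphG1 5 4 3 6 := by
    simp [IsInducedP4, graphG1, Fin.ext_iff]
  have p5 : IsInducedP4 graphG1 8 7 6 2 := by
    simp [IsInducedP4, graphG1, Fin.ext_iff]
  have p6 : IsInducedP4 graphG1 8 7 6 3 := by
    simp [IsInducedP4, graphG1, Fin.ext_iff]
  have h1 := opposition_iff hD hO p1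
  have h2 := opposition_iff hD hO p2
  have h3 := opposition_iff hD hO p3
  have h4 := opposition_iff hD hO p4
  have h5 := opposition_iff hD hO p5
  have h6 := opposition_iff hD hO p6
  have e1 := orientation_not hD p1.2.1.2.2
  have e2 := orientation_not hD p2.2.1.2.2
  have e3 := orientation_not hD p4.2.1.2.2
  grind

theorem graphG2_not_isGeneralizedOppositionGraph : ¬ IsGeneralizedOppositionGraph graphG2 := by
  rintro ⟨D, hD, hO⟩
  have p1 : IsInducedP4 graphG2 0 1 2 6 := by
    simp [IsInducedP4, graphG2, Fin.ext_iff]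
  have p2 : IsInducedP4 graphG2 6 2 7 8 := by
    simp [IsInducedP4, graphG2, Fin.ext_iff]
  have p3 : IsInducedP4 graphG2 6 3 7 8 := by
    simp [IsInducedP4, graphG2, Fin.ext_iff]
  have p4 : IsInducedP4 graphG2 5 4 3 6 := by
    simp [IsInducedP4, graphG2, Fin.ext_iff]
  have p5 : IsInducedP4 graphG2 0 1 2 3 := by
    simp [IsInducedP4, graphG2, Fin.ext_iff]
  have p6 : IsInducedP4 graphG2 5 4 3 2 := by
    simp [IsInducedP4, graphG2, Fin.ext_iff]
  have h1 := opposition_iff hD hO p1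
  have h2 := opposition_iff hD hO p2
  have h3 := opposition_iff hD hO p3
  have h4 := opposition_iff hD hO p4
  have h5 := opposition_iff hD hO p5
  have h6 := opposition_iff hD hO p6
  have e1 := orientation_not hD p5.2.1.2.2
  grind

theorem graphT_adj_iff {k m n : ℕ} (hm : m < 2 * k + 6) (hn : n < 2 * k + 6) :
    (graphT k).Adj ⟨m, hm⟩ ⟨n, hn⟩ ↔ m ≠ n ∧
      (((m + 1 = n ∧ n ≤ 2 * k + 3) ∨ (m = 2 ∧ n = 2 * k + 4) ∨ (m = 2 * k + 1 ∧ n = 2 * k + 5)) ∨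
      ((n + 1 = m ∧ m ≤ 2 * k + 3) ∨ (n = 2 ∧ m = 2 * k + 4) ∨
        (n = 2 * k + 1 ∧ m = 2 * k + 5))) := by
  rw [graphT, SimpleGraph.fromRel_adj, Ne, Fin.mk.injEq]

/-- Along the path of `T_k` the direction of every second edge is reversed, and the vertices of
degree three force equal directions of two consecutive edges at either end of the path; the two
conditions do not fit together. -/
theorem graphT_not_isGeneralizedOppositionGraph {k : ℕ} (hk : 1 ≤ k) :
    ¬ IsGeneralizedOppositionGraph (graphT k) := by
  rintro ⟨D, hD, hO⟩
  -- `s m n`: the edge between the vertices numbered `m` and `n` is directed towards `n`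
  set s : ℕ → ℕ → Prop := fun m n =>
    ∃ (hm : m < 2 * k + 6) (hn : n < 2 * k + 6), D ⟨m, hm⟩ ⟨n, hn⟩
  have hsD : ∀ {m n} (hm : m < 2 * k + 6) (hn : n < 2 * k + 6),
      (s m n ↔ D ⟨m, hm⟩ ⟨n, hn⟩) := fun hm hn => ⟨fun ⟨_, _, h⟩ => h, fun h => ⟨hm, hn, h⟩⟩
  have opp : ∀ {m n i j} (hm : m < 2 * k + 6) (hn : n < 2 * k + 6) (hi : i < 2 * k + 6)
      (hj : j < 2 * k + 6), IsInducedP4 (graphT k) ⟨m, hm⟩ ⟨n, hn⟩ ⟨i, hi⟩ ⟨j, hj⟩ →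
      (s m n ↔ s j i) := by
    intro m n i j hm hn hi hj h
    rw [hsD hm hn, hsD hj hi]
    exact opposition_iff hD hO h
  have hflip : ∀ n, n < 2 * k + 3 → (s n (n + 1) ↔ ¬ s (n + 1) n) := by
    intro n hn
    rw [hsD (by omega) (by omega), hsD (by omega) (by omega)]
    exact orientation_not hD (by rw [graphT_adj_iff]; omega)
  have step : ∀ n, n + 3 ≤ 2 * k + 3 → (s n (n + 1) ↔ ¬ s (n + 2) (n + 3)) := by
    intro n hn
    have h : s n (n + 1) ↔ s (n + 3) (n + 2) := opp (by omega) (by omega) (by omega) (by omega) ?_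
    · rw [h, hflip (n + 2) (by omega), not_not]
    simp only [IsInducedP4, graphT_adj_iff, Ne, Fin.mk.injEq, true_and]
    omega
  have start : s 0 1 ↔ s 1 2 := by
    have h1 : s 0 1 ↔ s (2 * k + 4) 2 := opp (by omega) (by omega) (by omega) (by omega) (by
      simp only [IsInducedP4, graphT_adj_iff, Ne, Fin.mk.injEq, true_and, and_true, true_or,
        or_true]
      omega)
    have h2 : s (2 * k + 4) 2 ↔ s 4 3 := opp (by omega) (by omega) (by omega) (by omega) (by
      simp only [IsInducedP4, graphT_adj_iff, Ne, Fin.mk.injEq, true_and, and_true, true_or,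
        or_true]
      omega)
    have h3 : s 3 4 ↔ ¬ s 4 3 := hflip 3 (by omega)
    have h4 : s 1 2 ↔ ¬ s 3 4 := step 1 (by omega)
    rw [h1, h2, h4, h3, not_not]
  have finish : s (2 * k + 2) (2 * k + 3) ↔ s (2 * k + 1) (2 * k + 2) := by
    have h1 : s (2 * k + 3) (2 * k + 2) ↔ s (2 * k + 5) (2 * k + 1) :=
      opp (by omega) (by omega) (by omega) (by omega) (by
        simp only [IsInducedP4, graphT_adj_iff, Ne, Fin.mk.injEq, true_and, and_true, true_or,
          or_true]
        omega)
    have h2 : s (2 * k + 5) (2 * k + 1) ↔ s (2 * k - 1) (2 * k) :=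
      opp (by omega) (by omega) (by omega) (by omega) (by
        simp only [IsInducedP4, graphT_adj_iff, Ne, Fin.mk.injEq, true_and, and_true,
          or_true]
        omega)
    have h3 : s (2 * k + 2) (2 * k + 3) ↔ ¬ s (2 * k + 3) (2 * k + 2) := hflip _ (by omega)
    have h4 := step (2 * k - 1) (by omega)
    rw [show 2 * k - 1 + 1 = 2 * k by omega, show 2 * k - 1 + 2 = 2 * k + 1 by omega,
      show 2 * k - 1 + 3 = 2 * k + 2 by omega] at h4
    rw [h3, h1, h2, h4, not_not]
  have iter : ∀ j ≤ k, (s (2 * j) (2 * j + 1) ↔ s (2 * j + 1) (2 * j + 2)) := by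
    intro j
    induction j with
    | zero => exact fun _ => start
    | succ j ih =>
      intro hj
      have h1 := step (2 * j) (by omega)
      have h2 := step (2 * j + 1) (by omega)
      exact not_iff_not.1 (h1.symm.trans ((ih (by omega)).trans h2))
  exact iff_not_self ((iter k le_rfl).symm.trans ((step (2 * k) (by omega)).trans
    (not_congr finish)))

/-! ### The auxiliary graph -/

theorem isBipartite_auxGraph {V : Type*} {G : SimpleGraph V}
    (hG : IsGeneralizedOppositionGraph G) : (auxGraph G).IsBipartite := by
  classical
  obtain ⟨D, hD, hO⟩ := hG
  have hadj : ∀ p : {p : V × V // IsEndEdge G p.1 p.2}, G.Adj p.1.1 p.1.2 := by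
    rintro ⟨⟨x, y⟩, u, v, h | h⟩
    · exact h.2.1.1
    · exact h.2.1.1.symm
  refine ⟨SimpleGraph.Coloring.mk (fun p => if D p.1.1 p.1.2 then (0 : Fin 2) else 1) ?_⟩
  intro p q hpq
  have key : D p.1.1 p.1.2 ↔ ¬ D q.1.1 q.1.2 := by
    have hp := orientation_not hD (hadj p)
    have hq := orientation_not hD (hadj q)
    rcases hpq with ⟨h1, h2⟩ | h | h
    · rw [h1, h2] at hp ⊢
      exact hp
    · have := opposition_iff hD hO h
      tauto
    · have := opposition_iff hD hO h
      tauto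
  by_cases h : D p.1.1 p.1.2
  · simp [h, key.1 h]
  · have h' : D q.1.1 q.1.2 := by tauto
    simp [h, h']

theorem isGeneralizedOppositionGraph_of_auxGraph {V : Type*} {G : SimpleGraph V}
    (h : (auxGraph G).IsBipartite) : IsGeneralizedOppositionGraph G := by
  classical
  obtain ⟨C⟩ := h
  have hsymm : ∀ {x y}, IsEndEdge G x y → IsEndEdge G y x := fun ⟨u, v, h⟩ => ⟨u, v, h.symm⟩
  -- end-edges follow the colouring, the remaining edges an arbitrary linear order
  set D : V → V → Prop := fun x y => G.Adj x y ∧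
    ((∃ h : IsEndEdge G x y, C ⟨(x, y), h⟩ = 0) ∨ (¬ IsEndEdge G x y ∧ WellOrderingRel x y))
    with hDdef
  have hD : ∀ {x y} (h : IsEndEdge G x y), G.Adj x y → (D x y ↔ C ⟨(x, y), h⟩ = 0) := by
    intro x y h hxy
    constructor
    · rintro ⟨-, ⟨_, h'⟩ | h'⟩
      · exact h'
      · exact absurd h h'.1
    · exact fun h' => ⟨hxy, Or.inl ⟨h, h'⟩⟩
  have hrev : ∀ {x y} (h : IsEndEdge G x y),
      C ⟨(x, y), h⟩ ≠ C ⟨(y, x), hsymm h⟩ := fun h => C.valid (Or.inl ⟨rfl, rfl⟩)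
  have two : ∀ {i j : Fin 2}, i ≠ j → (i = 0 ↔ ¬ j = 0) := by decide
  have hor : ∀ x y, G.Adj x y → (D x y ↔ ¬ D y x) := by
    intro x y hxy
    by_cases h : IsEndEdge G x y
    · rw [hD h hxy, hD (hsymm h) hxy.symm]
      exact two (hrev h)
    · have h' : ¬ IsEndEdge G y x := fun h' => h (hsymm h')
      simp only [hDdef, hxy, hxy.symm, h, h', IsEmpty.exists_iff, not_false_eq_true, true_and,
        false_or]
      rcases trichotomous_of WellOrderingRel x y with h1 | h1 | h1
      · exact iff_of_true h1 (asymm_of WellOrderingRel h1)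
      · exact absurd h1 hxy.ne
      · exact iff_of_false (asymm_of WellOrderingRel h1) (not_not.2 h1)
  refine ⟨D, ⟨fun x y h => h.1, fun x y h => ?_⟩, ?_⟩
  · have := hor x y h
    simp only [Xor]
    tauto
  · intro a b c d hP
    have e1 : IsEndEdge G a b := ⟨c, d, Or.inl hP⟩
    have e2 : IsEndEdge G c d := ⟨b, a, Or.inr hP.reverse⟩
    have hC : C ⟨(a, b), e1⟩ ≠ C ⟨(c, d), e2⟩ := C.valid (Or.inr (Or.inl hP))
    have h1 := two hC
    rw [← hD e1 hP.2.1.1, ← hD e2 hP.2.1.2.2] at h1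
    have h2 := hor a b hP.2.1.1
    have h3 := hor c d hP.2.1.2.2
    by_cases h : D a b
    · exact Or.inl ⟨h, not_not.1 fun h' => h1.1 h (h3.2 h')⟩
    · exact Or.inr ⟨not_not.1 fun h' => h (h2.2 h'), not_not.1 fun h' => h (h1.2 h')⟩

theorem theorem4p2 {V : Type*} [Finite V] (G : SimpleGraph V)
    (hG : OppositionGraph.IsDistanceHereditary G) :
    List.TFAE
      [OppositionGraph.IsOppositionGraph G,
       OppositionGraph.IsGeneralizedOppositionGraph G,
       (OppositionGraph.auxGraph G).IsBipartite,
       (∀ k : ℕ, 1 ≤ k → ¬ (OppositionGraph.graphT k).IsIndContained G) ∧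
         ¬ OppositionGraph.graphA.IsIndContained G ∧
         ¬ OppositionGraph.graphG1.IsIndContained G ∧
         ¬ OppositionGraph.graphG2.IsIndContained G] := by
  tfae_have 1 → 2 := fun ⟨D, h1, _, h3⟩ => ⟨D, h1, h3⟩
  tfae_have 2 → 3 := isBipartite_auxGraph
  tfae_have 3 → 2 := isGeneralizedOppositionGraph_of_auxGraph
  tfae_have 2 → 4 := fun h =>
    ⟨fun _ hk h' => graphT_not_isGeneralizedOppositionGraph hk
        (isGeneralizedOppositionGraph_mono h' h),
      fun h' => graphA_not_isGeneralizedOppositionGraph (isGeneralizedOppositionGraph_mono h' h),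
      fun h' => graphG1_not_isGeneralizedOppositionGraph (isGeneralizedOppositionGraph_mono h' h),
      fun h' => graphG2_not_isGeneralizedOppositionGraph (isGeneralizedOppositionGraph_mono h' h)⟩
  tfae_have 4 → 1 := fun ⟨hT, hA, h1, h2⟩ =>
    (IsExcluding.hasOppositionRanking _ rfl ⟨hG, hT, hA, h1, h2⟩).isOppositionGraph
  tfae_finish
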